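/- All graphs are finite and simple. For a connected graph $G$ and a path $P$ of $G$ (a single vertex is a path of length zero) let $\mathrm{ecc}_G(P)=\max_{u\in V(G)}\min_{v\in V(P)} d_G(u,v)$ and $\mathrm{pe}(G)=\min\{\mathrm{ecc}_G(P): P\text{ a path in }G\}$. A dominating path is a path $P$ with $\mathrm{ecc}_G(P)\le 1$. A bipartite graph $G=(X\cup Y,E)$ is biconvex if there are orderings $X=\{x_1,\dots,x_n\}$, $Y=\{y_1,\dots,y_m\}$ (a biconvex ordering) such that the neighbourhood of every vertex of one class is consecutive in the ordering of the other class. **Set-up.** Let $n,m\ge 1$. Given a biconvex ordering of a connected graph, let $x_L$ (resp. $x_R$) be the vertex of smallest (resp. largest) index among the vertices of $N(y_1)$ (resp. $N(y_m)$) whose neighbourhood is not properly contained in the neighbourhood of another vertex of $X$. Call the ordering admissible if $x_L\le x_R$; the orderings of $\{x_L,\dots,x_R\}$ and $Y$ are strong on $G_p:=G[\{x_L,\dots,x_R\}\cup Y]$, that is, for $x_i\le x_k$ in $\{x_L,\dots,x_R\}$ and $y_a\le y_c$, if $x_iy_c,x_ky_a\in E$ then $x_iy_a,x_ky_c\in E$;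 and $N(x_i)\subseteq N(x_j)$ whenever $i<j\le L$ or $R\le j<i$. The complete bipartite decomposition $(K_1,J_1),\dots,(K_k,J_k)$ of $G_p$ is obtained by repeating the following until no vertex is left: $K_i=N(x)\cup N(y)$, where $x$ and $y$ are the first remaining vertices of $X$ and of $Y$ and neighbourhoods are taken in the remaining graph; $J_i$ is the set of isolated vertices of the remaining graph minus $K_i$; delete $K_i\cup J_i$. Let $\ell_X(K_i),r_X(K_i)$ be the first and last vertices of $K_i\cap X$, and define $\ell_Y(K_i),r_Y(K_i)$ likewise. For $i<k$, say that $K_i$ is $XY$-linked if some edge joins a vertex of $K_i\cap X$ to a vertex of $K_{i+1}\cap Y$. Let $t_i=r_X(K_i)$ if $i=k$ or $K_i$ is $XY$-linked, and $t_i=r_Y(K_i)$ otherwise. **Algorithm.** Given a connected biconvex graph $G=(X\cup Y,E)$ with $X,Y\neq\emptyset$: 1. Take an admissible biconvex ordering and the decomposition of $G_p$. 2. If $r_Y(K_1)\in N(x_1)$, let $v=r_Y(K_1)$, and let $P=\langle\ell_X(K_1)\rangle$ if $t_1\ne\ell_X(K_1)$ and $P=\emptyset$ if $t_1=\ell_X(K_1)$.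 Otherwise let $P=\emptyset$ and let $v$ be the first vertex of $N(x_1)$. 3. For $i=1,\dots,k$: append to $P$ any path from $v$ to $t_i$ with all its vertices in $K_i$ and vertex-disjoint from $P$; if $i<k$, let $v=\ell_Y(K_{i+1})$ if $K_i$ is $XY$-linked and $v=\ell_X(K_{i+1})$ otherwise. 4. If $N(x_n)\cap J_k\ne\emptyset$, append any vertex of this set to $P$; otherwise, if $V(P)\cap N(x_n)=\emptyset$, append any vertex of $N(x_n)$ to $P$. Return $P$. **Theorem.** (a) Every connected biconvex graph $G$ has a dominating path; equivalently, $\mathrm{pe}(G)\le 1$. (b) If $G=(X\cup Y,E)$ is a connected biconvex graph with $X,Y\ne\emptyset$, then $X\cup Y$ has an admissible biconvex ordering; and for every admissible ordering, and however the choices in steps 3 and 4 are made, the decomposition terminates and the algorithm returns a dominating path of $G$. (c) The bound is tight even for $k$-connected graphs: for every integer $k\ge 1$ the complete bipartite graph $K_{k,k+2}$ is biconvex and $k$-connected, and $\mathrm{pe}(K_{k,k+2})=1$. -/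

import Mathlib

namespace BiconvexPath

/-! ### Path eccentricity, dominating paths, connectivity -/

section Graph

variable {V : Type*} (G : SimpleGraph V)

/-- `max {d(w, S) : w ∈ V(G)}`, where `d(w, S) = min {d(w, z) : z ∈ S}`. -/
noncomputable def eccSet (S : Set V) : ℕ∞ := ⨆ w, ⨅ z ∈ S, G.edist w z

/-- The eccentricity of a path: the largest distance of a vertex of `G` to the path. -/
noncomputable def pathEcc {u v : V} (p : G.Path u v) : ℕ∞ :=
  eccSet G {z | z ∈ (p : G.Walk u v).support}

/-- The path eccentricity of `G`: the smallest eccentricity of a path of `G`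
(single vertices are paths of length zero). -/
noncomputable def pe : ℕ∞ := ⨅ (u : V) (v : V) (p : G.Path u v), pathEcc G p

/-- The list `P` is the vertex sequence of a dominating path of `G`,
that is, of a path of eccentricity at most one. -/
def IsDominatingPath (P : List V) : Prop :=
  ∃ (u v : V) (p : G.Path u v), (p : G.Walk u v).support = P ∧ pathEcc G p ≤ 1

/-- `G` is `k`-connected: it has more than `k` vertices, and deleting fewer than `k` vertices
leaves a connected graph. -/
def IsKConnected (k : ℕ) : Prop :=
  (k : ℕ∞) < ENat.card V ∧
    ∀ S : Finset V, S.card < k → (G.induce {v | v ∉ S}).Connected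

/-- A bipartition `V(G) = X ∪ Y` into independent sets, together with orderings
`X = {x 0, …, x (n - 1)}` and `Y = {y 0, …, y (m - 1)}`. -/
structure BipartiteOrdering (n m : ℕ) where
  x : Fin n → V
  y : Fin m → V
  x_injective : Function.Injective x
  y_injective : Function.Injective y
  x_ne_y : ∀ i j, x i ≠ y j
  cover : ∀ v, (∃ i, x i = v) ∨ (∃ j, y j = v)
  not_adj_x : ∀ i i', ¬ G.Adj (x i) (x i')
  not_adj_y : ∀ j j', ¬ G.Adj (y j) (y j')

/-- The vertices `Q` form a path of `G` from `a` to `b`, all of whose vertices lie in `K`. -/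
def IsPathIn (K : Set V) (a b : V) (Q : List V) : Prop :=
  Q.IsChain G.Adj ∧ Q.Nodup ∧ Q.head? = some a ∧ Q.getLast? = some b ∧ ∀ v ∈ Q, v ∈ K

/-- A way to resolve the arbitrary choices ("let `P'` be a path", "let `u` be a vertex") made by
the algorithm. `path P K a b` is a path from `a` to `b` in `K` that can be concatenated to the
path `P` constructed so far (it is vertex-disjoint from `P`), whenever there is one;
`vertex S` is an element of `S`, whenever there is one. -/
structure Choices where
  path : List V → Set V → V → V → List V
  vertex : Set V → V
  path_spec : ∀ P K a b, (∃ Q, IsPathIn G K a b Q ∧ P.Disjoint Q) →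
    IsPathIn G K a b (path P K a b) ∧ P.Disjoint (path P K a b)
  vertex_spec : ∀ S : Set V, S.Nonempty → vertex S ∈ S

theorem nonempty_choices [Nonempty V] : Nonempty (Choices G) := by
  classical
  refine ⟨⟨fun P K a b => if h : ∃ Q, IsPathIn G K a b Q ∧ P.Disjoint Q then h.choose else [],
    fun S => if h : S.Nonempty then h.some else Classical.arbitrary V, ?_, ?_⟩⟩
  · intro P K a b h
    simp only [dif_pos h]
    exact h.choose_spec
  · intro S h
    simp only [dif_pos h]
    exact h.some_mem

end Graph

namespace BipartiteOrdering

variable {V : Type*} {G : SimpleGraph V}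

/-- The ordering of `X` is convex (the neighbours of each `y ∈ Y` are consecutive in it),
and the ordering of `Y` is convex (the neighbours of each `x ∈ X` are consecutive in it). -/
def IsBiconvex {n m : ℕ} (O : BipartiteOrdering G n m) : Prop :=
  (∀ j, {i | G.Adj (O.x i) (O.y j)}.OrdConnected) ∧
    (∀ i, {j | G.Adj (O.x i) (O.y j)}.OrdConnected)

end BipartiteOrdering

/-- `G` is a (finite) biconvex graph: it is bipartite with a biconvex ordering. -/
def IsBiconvex {V : Type*} (G : SimpleGraph V) : Prop :=
  ∃ (n m : ℕ) (O : BipartiteOrdering G n m), O.IsBiconvex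

namespace BipartiteOrdering

/-! ### The algorithm

From here on both colour classes are nonempty. Indices start from `0`, so that `x 0` and
`x (Fin.last n)` are the first and the last vertex of `X`. -/

variable {V : Type*} {G : SimpleGraph V} {n m : ℕ} (O : BipartiteOrdering G (n + 1) (m + 1))

/-- The neighbourhood of `x i` is not properly contained in that of another vertex of `X`. -/
def IsMaximal (i : Fin (n + 1)) : Prop :=
  ∀ i', ¬ G.neighborSet (O.x i) ⊂ G.neighborSet (O.x i')

/-- The index of `x_L`: the smallest index of a vertex with maximal neighbourhood
adjacent to the first vertex of `Y`. -/
noncomputable def L : Fin (n + 1) := sInf {i | G.Adj (O.x i) (O.y 0) ∧ O.IsMaximal i}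

/-- The index of `x_R`: the largest index of a vertex with maximal neighbourhood
adjacent to the last vertex of `Y`. -/
noncomputable def R : Fin (n + 1) := sSup {i | G.Adj (O.x i) (O.y (Fin.last m)) ∧ O.IsMaximal i}

/-- The orderings `{x_L, …, x_R}` and `Y` are a strong ordering of the induced subgraph `G_p` of
`G` on `{x_L, …, x_R} ∪ Y` (so that `G_p` is a bipartite permutation graph). -/
def IsStrongOnCore : Prop :=
  ∀ i k, O.L ≤ i → i ≤ k → k ≤ O.R → ∀ a c, a ≤ c →
    G.Adj (O.x i) (O.y c) → G.Adj (O.x k) (O.y a) →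
      G.Adj (O.x i) (O.y a) ∧ G.Adj (O.x k) (O.y c)

/-- The orderings the algorithm starts from: biconvex, with `x_L ≤ x_R`, strong on `G_p`, and
with neighbourhoods increasing up to `x_L` and decreasing from `x_R` on. -/
structure IsAdmissible : Prop where
  biconvex : O.IsBiconvex
  L_le_R : O.L ≤ O.R
  strong : O.IsStrongOnCore
  nested : ∀ i j, (i < j ∧ j ≤ O.L) ∨ (O.R ≤ j ∧ j < i) →
    G.neighborSet (O.x i) ⊆ G.neighborSet (O.x j)

/-- `ℓ_X(K)`, the first vertex of `X` in `K`. -/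
noncomputable def lX (K : Set V) : V := O.x (sInf {i | O.x i ∈ K})

/-- `r_X(K)`, the last vertex of `X` in `K`. -/
noncomputable def rX (K : Set V) : V := O.x (sSup {i | O.x i ∈ K})

/-- `ℓ_Y(K)`, the first vertex of `Y` in `K`. -/
noncomputable def lY (K : Set V) : V := O.y (sInf {j | O.y j ∈ K})

/-- `r_Y(K)`, the last vertex of `Y` in `K`. -/
noncomputable def rY (K : Set V) : V := O.y (sSup {j | O.y j ∈ K})

/-- `N(x) ∪ N(y)` in the subgraph induced by `S`, for the first `x ∈ X` and `y ∈ Y` in `S`. -/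
def blockK (S : Set V) : Set V :=
  {v | v ∈ S ∧ (G.Adj (O.lX S) v ∨ G.Adj (O.lY S) v)}

/-- The isolated vertices of the subgraph induced by `S` minus the block of `S`. -/
def blockJ (S : Set V) : Set V :=
  {v | v ∈ S \ O.blockK S ∧ ∀ w ∈ S \ O.blockK S, ¬ G.Adj v w}

/-- The vertices of `G_p` left after `i` steps of the complete bipartite decomposition. -/
def remaining : ℕ → Set V
  | 0 => {v | (∃ i, O.L ≤ i ∧ i ≤ O.R ∧ O.x i = v) ∨ ∃ j, O.y j = v}
  | i + 1 => remaining i \ (O.blockK (remaining i) ∪ O.blockJ (remaining i))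

/-- The vertex sets `K 0, …, K (k - 1)` of the complete bipartite decomposition of `G_p`. -/
def K (i : ℕ) : Set V := O.blockK (O.remaining i)

/-- The vertex sets `J 0, …, J (k - 1)` of the complete bipartite decomposition of `G_p`. -/
def J (i : ℕ) : Set V := O.blockJ (O.remaining i)

/-- The number `k` of steps after which no vertex is left in the decomposition. -/
noncomputable def k : ℕ := sInf {i | O.remaining i = ∅}

/-- `K i` is linked to `K (i + 1)` by an `XY`-edge: one with its end in `K i` in `X`. -/
def LinkedXY (i : ℕ) : Prop :=
  ∃ a b, O.x a ∈ O.K i ∧ O.y b ∈ O.K (i + 1) ∧ G.Adj (O.x a) (O.y b)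

open Classical in
/-- The vertex at which the part of the path inside `K i` ends. -/
noncomputable def exit (i : ℕ) : V :=
  if i + 1 = O.k ∨ O.LinkedXY i then O.rX (O.K i) else O.rY (O.K i)

open Classical in
/-- The vertex of `K (i + 1)` at which the path is continued after `K i`. -/
noncomputable def entry (i : ℕ) : V :=
  if O.LinkedXY i then O.lY (O.K (i + 1)) else O.lX (O.K (i + 1))

open Classical in
/-- The initial values of the path `P` and of the start vertex `v` of its next part.
If `r_Y(K_1)` is a neighbour of the first vertex of `X`, then `P` is the one-vertex path
`ℓ_X(K_1)`, unless the path through `K_1` is going to end in that vertex anyway. -/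
noncomputable def init : List V × V :=
  if G.Adj (O.x 0) (O.rY (O.K 0)) then
    (if O.exit 0 = O.lX (O.K 0) then [] else [O.lX (O.K 0)], O.rY (O.K 0))
  else
    ([], O.y (sInf {j | G.Adj (O.x 0) (O.y j)}))

/-- The path `P` and the start vertex `v` of its next part after the first `i` blocks. -/
noncomputable def loop (σ : Choices G) : ℕ → List V × V
  | 0 => O.init
  | i + 1 =>
    ((loop σ i).1 ++ σ.path (loop σ i).1 (O.K i) (loop σ i).2 (O.exit i), O.entry i)

/-- The path after all `k` blocks; its part in the last block ends in `r_X(K_k)`. -/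
noncomputable def mainPart (σ : Choices G) : List V :=
  (O.loop σ (O.k - 1)).1 ++
    σ.path (O.loop σ (O.k - 1)).1 (O.K (O.k - 1)) (O.loop σ (O.k - 1)).2 (O.rX (O.K (O.k - 1)))

open Classical in
/-- The output of the algorithm: if the last vertex `x_n` of `X` has neighbours in `J_k`, append
one of them; otherwise, if no neighbour of `x_n` is on the path yet, append one. -/
noncomputable def output (σ : Choices G) : List V :=
  if (G.neighborSet (O.x (Fin.last n)) ∩ O.J (O.k - 1)).Nonempty then
    O.mainPart σ ++ [σ.vertex (G.neighborSet (O.x (Fin.last n)) ∩ O.J (O.k - 1))]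
  else if ∃ w ∈ O.mainPart σ, w ∈ G.neighborSet (O.x (Fin.last n)) then
    O.mainPart σ
  else
    O.mainPart σ ++ [σ.vertex (G.neighborSet (O.x (Fin.last n)))]

end BipartiteOrdering

end BiconvexPath

/-! The vertices `x_L` and `x_R` see the two ends of `Y`. If `x_L ≤ x_R`, convexity makes the part
of `G` between them strongly ordered, and makes neighbourhoods shrink from `x_L` towards the first
vertex of `X` and from `x_R` towards the last one (`IsBiconvex.isAdmissible`). If `x_L > x_R`,
reversing `X` restores the inequality. Both facts rest on `IsBiconvex.exists_lt_adj_iff`: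
connectivity forbids the neighbours of `y` from jumping over a vertex `x` while `y` runs through
consecutive non-neighbours of `x`.

In a strong ordering crossing edges can be uncrossed. Hence each step of the decomposition splits
off a complete bipartite block that is an interval in both classes, followed by isolated vertices in
at most one class, and what is left is of the same kind (`IsTail.exists_isBlock`). The last vertex
of the block in one of the classes sees the first vertex of the next block and all the isolated
vertices: this is the exit chosen by the algorithm (`IsAdmissible.adj_exit`). So the pieces inside
the blocks can be concatenated, and the exits dominate the isolated vertices.

A piece dominates its block because it contains an edge of it, or because its only vertex is a whole
class of the block. Outside the core, nestedness leaves only two demands: the path must meet the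
neighbourhoods of the first and of the last vertex of `X`. The initialisation meets the first
demand, the final step the second. The invariant along the loop is `IsPathThrough`.

For tightness, a path alternates between the two classes, so it cannot cover `K_{k,k+2}`, whereas
any single edge dominates it. -/

namespace BiconvexPath

/-! ### Dominating paths as lists of vertices -/

section Graph

variable {V : Type*} {G : SimpleGraph V}

theorem isDominatingPath_of_isChain {P : List V} (hc : P.IsChain G.Adj) (hn : P.Nodup)
    (hne : P ≠ []) (hd : ∀ w, w ∈ P ∨ ∃ z ∈ P, G.Adj z w) : IsDominatingPath G P := by
  have hs := SimpleGraph.Walk.support_ofSupport hne hc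
  refine ⟨_, _, ⟨SimpleGraph.Walk.ofSupport P hne hc, ?_⟩, hs, ?_⟩
  · rw [SimpleGraph.Walk.isPath_def, hs]
    exact hn
  · refine iSup_le fun w => ?_
    simp only [hs]
    rcases hd w with h | ⟨z, hz, h⟩
    · exact (iInf₂_le w h).trans (by simp)
    · refine (iInf₂_le z hz).trans ?_
      exact (SimpleGraph.edist_eq_one_iff_adj.2 h.symm).le

theorem IsDominatingPath.pe_le_one {P : List V} (h : IsDominatingPath G P) : pe G ≤ 1 := by
  obtain ⟨u, v, p, -, hp⟩ := h
  exact (iInf_le_of_le u <| iInf_le_of_le v <| iInf_le _ p).trans hp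

theorem IsPathIn.ne_nil {K : Set V} {a b : V} {Q : List V} (h : IsPathIn G K a b Q) :
    Q ≠ [] := by
  rintro rfl
  simpa using h.2.2.1

theorem IsPathIn.head_mem {K : Set V} {a b : V} {Q : List V} (h : IsPathIn G K a b Q) :
    a ∈ Q := List.mem_of_head? h.2.2.1

theorem IsPathIn.getLast_mem {K : Set V} {a b : V} {Q : List V} (h : IsPathIn G K a b Q) :
    b ∈ Q := List.mem_of_getLast? h.2.2.2.1

theorem exists_adj_of_isChain {Q : List V} (hc : Q.IsChain G.Adj) {a b : V} (ha : a ∈ Q)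
    (hb : b ∈ Q) (hab : a ≠ b) : ∃ c ∈ Q, ∃ d ∈ Q, G.Adj c d := by
  match Q, hc with
  | [], _ => simp at ha
  | [c], _ => simp_all
  | c :: d :: l, hc => exact ⟨c, by simp, d, by simp, (List.isChain_cons_cons.1 hc).1⟩

end Graph

/-! ### Tightness: complete bipartite graphs -/

section CompleteBipartite

open Sum

theorem isBiconvex_completeBipartiteGraph (a b : ℕ) :
    IsBiconvex (completeBipartiteGraph (Fin a) (Fin b)) := by
  refine ⟨a, b, ⟨inl, inr, inl_injective, inr_injective, by simp, ?_, by simp, by simp⟩, ?_⟩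
  · rintro (i | j) <;> simp
  · constructor <;> intro <;> simp [Set.ordConnected_univ]

theorem isKConnected_completeBipartiteGraph {k a b : ℕ} (ha : k ≤ a) (hb : k ≤ b)
    (hk : 1 ≤ k) : IsKConnected (completeBipartiteGraph (Fin a) (Fin b)) k := by
  constructor
  · simp only [ENat.card_eq_coe_fintype_card, Fintype.card_sum, Fintype.card_fin]
    exact_mod_cast (by omega : k < a + b)
  · intro S hS
    -- Fewer than `k` deletions leave a vertex on each side; the edge between these two reaches
    -- everything else.
    obtain ⟨l, hl⟩ : ∃ l : Fin a, inl l ∉ S := by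
      by_contra! h
      have := Finset.card_le_card_of_injOn (s := Finset.univ) (t := S) (inl : Fin a → Fin a ⊕ Fin b)
        (fun i _ => h i) inl_injective.injOn
      simp at this
      omega
    obtain ⟨r, hr⟩ : ∃ r : Fin b, inr r ∉ S := by
      by_contra! h
      have := Finset.card_le_card_of_injOn (s := Finset.univ) (t := S) (inr : Fin b → Fin a ⊕ Fin b)
        (fun i _ => h i) inr_injective.injOn
      simp at this
      omega
    rw [SimpleGraph.connected_iff_exists_forall_reachable]
    refine ⟨⟨inl l, hl⟩, ?_⟩
    have hr' : ((completeBipartiteGraph (Fin a) (Fin b)).induce {v | v ∉ S}).Adj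
        ⟨inl l, hl⟩ ⟨inr r, hr⟩ := by simp
    rintro ⟨i | j, h⟩
    · refine hr'.reachable.trans (SimpleGraph.Adj.reachable ?_)
      simp
    · apply SimpleGraph.Adj.reachable
      simp

/-- The vertices of a walk alternate between the sides. Recording the side of the first vertex is
what makes the induction on the walk go through. -/
theorem countP_isRight_support_le {α β : Type*} {u v : α ⊕ β}
    (p : (completeBipartiteGraph α β).Walk u v) :
    p.support.countP (·.isRight) ≤ p.support.countP (·.isLeft) + if u.isRight then 1 else 0 := by
  induction p with
  | @nil u => cases u <;> simp
  | @cons u v w h p ih =>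
    rw [SimpleGraph.Walk.support_cons]
    cases u <;> cases v <;> simp_all [List.countP_cons]

theorem one_le_pe_completeBipartiteGraph {a b : ℕ} (hab : a + 2 ≤ b) :
    1 ≤ pe (completeBipartiteGraph (Fin a) (Fin b)) := by
  refine le_iInf fun u => le_iInf fun v => le_iInf fun p => ?_
  obtain ⟨w, hw⟩ : ∃ w, w ∉ (p : (completeBipartiteGraph (Fin a) (Fin b)).Walk u v).support := by
    by_contra! h
    -- A path through all vertices would have `b ≥ a + 2` vertices on the right and only `a` on the
    -- left.
    have hc := countP_isRight_support_le (p : (completeBipartiteGraph (Fin a) (Fin b)).Walk u v)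
    let l : List (Fin a ⊕ Fin b) := (List.finRange a).map inl ++ (List.finRange b).map inr
    have hl : l.Nodup := List.Nodup.append ((List.nodup_finRange a).map inl_injective)
      ((List.nodup_finRange b).map inr_injective) (by simp [List.Disjoint])
    have hp : (p : (completeBipartiteGraph (Fin a) (Fin b)).Walk u v).support.Perm
        l := (List.perm_ext_iff_of_nodup p.2.support_nodup hl).2 fun w => by
          rcases w with w | w <;> simp [h, l]
    rw [hp.countP_eq, hp.countP_eq] at hc
    simp [l, List.countP_map, Function.comp_def] at hc
    split_ifs at hc <;> omega
  refine le_trans ?_ (le_iSup _ w)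
  refine le_iInf₂ fun z hz => ?_
  rw [Order.one_le_iff_ne_zero, Ne, SimpleGraph.edist_eq_zero_iff]
  rintro rfl
  exact hw hz

theorem pe_completeBipartiteGraph {k : ℕ} (hk : 1 ≤ k) :
    pe (completeBipartiteGraph (Fin k) (Fin (k + 2))) = 1 := by
  refine le_antisymm ?_ (one_le_pe_completeBipartiteGraph le_rfl)
  refine IsDominatingPath.pe_le_one (P := [inl ⟨0, hk⟩, inr 0])
    (isDominatingPath_of_isChain (by simp) (by simp) (by simp) ?_)
  rintro (i | j) <;> simp

end CompleteBipartite

namespace BipartiteOrdering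

/-! ### Convexity and connectivity -/

section Convex

variable {V : Type*} {G : SimpleGraph V} {n m : ℕ}

/-- Exchange the colour classes. -/
def swap (O : BipartiteOrdering G n m) : BipartiteOrdering G m n where
  x := O.y
  y := O.x
  x_injective := O.y_injective
  y_injective := O.x_injective
  x_ne_y i j := (O.x_ne_y j i).symm
  cover v := (O.cover v).symm
  not_adj_x := O.not_adj_y
  not_adj_y := O.not_adj_x

/-- Reverse the ordering of the first colour class. -/
def revX (O : BipartiteOrdering G n m) : BipartiteOrdering G n m where
  x i := O.x i.rev
  y := O.y
  x_injective := O.x_injective.comp Fin.rev_injective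
  y_injective := O.y_injective
  x_ne_y i j := O.x_ne_y _ j
  cover v := by
    rcases O.cover v with ⟨i, hi⟩ | h
    · exact .inl ⟨i.rev, by simpa using hi⟩
    · exact .inr h
  not_adj_x _ _ := O.not_adj_x _ _
  not_adj_y := O.not_adj_y

theorem IsBiconvex.swap {O : BipartiteOrdering G n m} (h : O.IsBiconvex) : O.swap.IsBiconvex := by
  constructor
  · intro j
    simpa only [BipartiteOrdering.swap, G.adj_comm] using h.2 j
  · intro j
    simpa only [BipartiteOrdering.swap, G.adj_comm] using h.1 j

theorem IsBiconvex.revX {O : BipartiteOrdering G n m} (h : O.IsBiconvex) : O.revX.IsBiconvex := by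
  refine ⟨fun j => ⟨fun a ha b hb c hc => ?_⟩, fun i => h.2 i.rev⟩
  exact (h.1 j).out hb ha ⟨Fin.rev_le_rev.2 hc.2, Fin.rev_le_rev.2 hc.1⟩

theorem IsBiconvex.adj_x {O : BipartiteOrdering G n m} (h : O.IsBiconvex) {i i' i'' : Fin n}
    {j : Fin m} (h1 : G.Adj (O.x i) (O.y j)) (h2 : G.Adj (O.x i'') (O.y j)) (hi : i ≤ i')
    (hi' : i' ≤ i'') : G.Adj (O.x i') (O.y j) :=
  (h.1 j).out h1 h2 ⟨hi, hi'⟩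

theorem IsBiconvex.adj_y {O : BipartiteOrdering G n m} (h : O.IsBiconvex) {i : Fin n}
    {j j' j'' : Fin m} (h1 : G.Adj (O.x i) (O.y j)) (h2 : G.Adj (O.x i) (O.y j'')) (hj : j ≤ j')
    (hj' : j' ≤ j'') : G.Adj (O.x i) (O.y j') :=
  (h.2 i).out h1 h2 ⟨hj, hj'⟩

theorem exists_x_of_adj_y (O : BipartiteOrdering G n m) {v : V} {j : Fin m} (h : G.Adj v (O.y j)) :
    ∃ i, O.x i = v := by
  rcases O.cover v with h' | ⟨j', rfl⟩
  · exact h'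
  · exact (O.not_adj_y _ _ h).elim

theorem exists_y_of_adj_x (O : BipartiteOrdering G n m) {v : V} {i : Fin n} (h : G.Adj (O.x i) v) :
    ∃ j, O.y j = v := O.swap.exists_x_of_adj_y h.symm

theorem neighborSet_subset_iff (O : BipartiteOrdering G n m) {i i' : Fin n} :
    G.neighborSet (O.x i) ⊆ G.neighborSet (O.x i') ↔
      ∀ j, G.Adj (O.x i) (O.y j) → G.Adj (O.x i') (O.y j) := by
  refine ⟨fun h j hj => h hj, fun h v hv => ?_⟩
  obtain ⟨j, rfl⟩ := O.exists_y_of_adj_x hv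
  exact h j hv

/-- In a connected graph two consecutive vertices of a class have a common neighbour. -/
theorem IsBiconvex.exists_common_neighbor_y {O : BipartiteOrdering G n m} (h : O.IsBiconvex)
    (hG : G.Connected) {j j' : Fin m} (hj : (j' : ℕ) = j + 1) :
    ∃ i, G.Adj (O.x i) (O.y j) ∧ G.Adj (O.x i) (O.y j') := by
  by_contra! hno
  -- Without a common neighbour, the vertices `y a` with `a ≤ j` together with their neighbours are
  -- closed under adjacency, so no walk leads from `y j` to `y j'`.
  have key : ∀ u v, G.Walk u v → ((∃ a ≤ j, O.y a = u) ∨ ∃ a ≤ j, G.Adj u (O.y a)) →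
      ((∃ a ≤ j, O.y a = v) ∨ ∃ a ≤ j, G.Adj v (O.y a)) := by
    intro u v p
    induction p with
    | nil => exact id
    | @cons u v w huv p ih =>
      intro hu
      apply ih
      rcases hu with ⟨a, ha, rfl⟩ | ⟨a, ha, hua⟩
      · exact .inr ⟨a, ha, huv.symm⟩
      · obtain ⟨i, rfl⟩ := O.exists_x_of_adj_y hua
        obtain ⟨b, rfl⟩ := O.exists_y_of_adj_x huv
        left
        refine ⟨b, ?_, rfl⟩
        by_contra! hb
        have hb' : j' ≤ b := by rw [Fin.le_def]; rw [Fin.lt_def] at hb; omega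
        have hjj : j ≤ j' := by rw [Fin.le_def]; omega
        exact hno i (h.adj_y hua huv ha hb.le) (h.adj_y hua huv (ha.trans hjj) hb')
  obtain ⟨p⟩ := hG.preconnected (O.y j) (O.y j')
  rcases key _ _ p (.inl ⟨j, le_rfl, rfl⟩) with ⟨a, ha, e⟩ | ⟨a, ha, e⟩
  · have := O.y_injective e
    subst this
    rw [Fin.le_def] at ha
    omega
  · exact O.not_adj_y _ _ e

theorem IsBiconvex.exists_common_neighbor_x {O : BipartiteOrdering G n m} (h : O.IsBiconvex)
    (hG : G.Connected) {i i' : Fin n} (hi : (i' : ℕ) = i + 1) :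
    ∃ j, G.Adj (O.x i) (O.y j) ∧ G.Adj (O.x i') (O.y j) := by
  obtain ⟨j, h1, h2⟩ := h.swap.exists_common_neighbor_y hG hi
  exact ⟨j, h1.symm, h2.symm⟩

/-- If `x i` has no neighbour among `y a, …, y c`, then `y a` and `y c` have their neighbours on
the same side of `x i`. -/
theorem IsBiconvex.exists_lt_adj_iff {O : BipartiteOrdering G n m} (h : O.IsBiconvex)
    (hG : G.Connected) {i : Fin n} {a c : Fin m} (hac : a ≤ c)
    (hno : ∀ j, a ≤ j → j ≤ c → ¬ G.Adj (O.x i) (O.y j)) :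
    (∃ i' < i, G.Adj (O.x i') (O.y a)) ↔ ∃ i' < i, G.Adj (O.x i') (O.y c) := by
  obtain ⟨c, hc⟩ := c
  induction c with
  | zero =>
    have : a = ⟨0, hc⟩ := by ext; simpa [Fin.le_def] using hac
    rw [this]
  | succ c ih =>
    rcases hac.eq_or_lt with rfl | hlt
    · rfl
    rw [Fin.lt_def] at hlt
    have hac' : a ≤ ⟨c, by omega⟩ := by rw [Fin.le_def]; simp at hlt ⊢; omega
    have hcc : (⟨c, by omega⟩ : Fin m) ≤ ⟨c + 1, hc⟩ := by simp
    rw [ih (by omega) hac' fun j h1 h2 => hno j h1 (h2.trans hcc)]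
    obtain ⟨k, hk1, hk2⟩ := h.exists_common_neighbor_y hG
      (j := ⟨c, by omega⟩) (j' := ⟨c + 1, hc⟩) rfl
    -- By convexity all neighbours of such a `y j` are on one side of `x i`, so any one of them,
    -- here the common neighbour `x k`, decides the side.
    have side : ∀ j, a ≤ j → j ≤ ⟨c + 1, hc⟩ → G.Adj (O.x k) (O.y j) →
        ((∃ i' < i, G.Adj (O.x i') (O.y j)) ↔ k < i) := by
      intro j h1 h2 hkj
      refine ⟨fun ⟨i', hi', hadj⟩ => ?_, fun hk => ⟨k, hk, hkj⟩⟩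
      by_contra! hik
      exact hno j h1 h2 (h.adj_x hadj hkj hi'.le hik)
    rw [side _ hac' hcc hk1, side _ hac le_rfl hk2]

end Convex

/-! ### Admissible orderings -/

section Admissible

variable {V : Type*} {G : SimpleGraph V} {n m : ℕ} {O : BipartiteOrdering G (n + 1) (m + 1)}

theorem exists_adj_x (O : BipartiteOrdering G (n + 1) (m + 1)) (hG : G.Connected)
    (i : Fin (n + 1)) : ∃ j, G.Adj (O.x i) (O.y j) := by
  have : Nontrivial V := ⟨O.x 0, O.y 0, O.x_ne_y 0 0⟩
  obtain ⟨v, hv⟩ := hG.preconnected.exists_adj_of_nontrivial (O.x i)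
  obtain ⟨j, rfl⟩ := O.exists_y_of_adj_x hv
  exact ⟨j, hv⟩

theorem exists_adj_y (O : BipartiteOrdering G (n + 1) (m + 1)) (hG : G.Connected)
    (j : Fin (m + 1)) : ∃ i, G.Adj (O.x i) (O.y j) := by
  obtain ⟨i, hi⟩ := O.swap.exists_adj_x hG j
  exact ⟨i, hi.symm⟩

/-- Maximality among the neighbours of `y j` suffices: a vertex with a larger neighbourhood is again
a neighbour of `y j`. -/
theorem exists_isMaximal_adj (O : BipartiteOrdering G (n + 1) (m + 1)) (hG : G.Connected)
    (j : Fin (m + 1)) : ∃ i, G.Adj (O.x i) (O.y j) ∧ O.IsMaximal i := by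
  obtain ⟨i, hi, hmax⟩ := ((Set.toFinite {i | G.Adj (O.x i) (O.y j)}).exists_maximalFor
    (fun i => G.neighborSet (O.x i)) _ (O.exists_adj_y hG j))
  refine ⟨i, hi, fun i' hlt => hlt.2 (hmax (hlt.1 hi) hlt.1)⟩

theorem adj_L (O : BipartiteOrdering G (n + 1) (m + 1)) (hG : G.Connected) :
    G.Adj (O.x O.L) (O.y 0) :=
  (Set.Nonempty.csInf_mem (O.exists_isMaximal_adj hG 0) (Set.toFinite _)).1

theorem adj_R (O : BipartiteOrdering G (n + 1) (m + 1)) (hG : G.Connected) :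
    G.Adj (O.x O.R) (O.y (Fin.last m)) :=
  (Set.Nonempty.csSup_mem (O.exists_isMaximal_adj hG (Fin.last m)) (Set.toFinite _)).1

theorem isMaximal_L (O : BipartiteOrdering G (n + 1) (m + 1)) (hG : G.Connected) :
    O.IsMaximal O.L :=
  (Set.Nonempty.csInf_mem (O.exists_isMaximal_adj hG 0) (Set.toFinite _)).2

theorem isMaximal_R (O : BipartiteOrdering G (n + 1) (m + 1)) (hG : G.Connected) :
    O.IsMaximal O.R :=
  (Set.Nonempty.csSup_mem (O.exists_isMaximal_adj hG (Fin.last m)) (Set.toFinite _)).2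

/-- Each failure of strongness or nestedness yields a vertex of `X` with no neighbour in an initial
or final segment of `Y`, to which `exists_lt_adj_iff` applies. The edges from `x_L` to the first and
from `x_R` to the last vertex of `Y` then force, by convexity, an edge that was excluded. -/
theorem IsBiconvex.isAdmissible (h : O.IsBiconvex) (hG : G.Connected) (hLR : O.L ≤ O.R) :
    O.IsAdmissible := by
  have hL := O.adj_L hG
  have hR := O.adj_R hG
  refine ⟨h, hLR, ?_, ?_⟩
  · intro i k hLi hik hkR a c hac hic hka
    constructor
    · by_contra hia
      -- The vertex `x i` misses `y 0, …, y a`. As `x_L` is a neighbour of `y 0` to the left of `x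
      -- i`, also `y a` has a neighbour on the left; but `x k` is one on the right.
      have hLi' : O.L < i := lt_of_le_of_ne hLi fun e => hia (h.adj_y (e ▸ hL) hic (Fin.zero_le _) hac)
      obtain ⟨i', hi', hadj⟩ := (h.exists_lt_adj_iff hG (Fin.zero_le a) (i := i)
        fun j _ hj hij => hia (h.adj_y hij hic hj hac)).1 ⟨_, hLi', hL⟩
      exact hia (h.adj_x hadj hka hi'.le hik)
    · by_contra hkc
      have hkR' : k < O.R :=
        lt_of_le_of_ne hkR fun e => hkc (h.adj_y hka (e ▸ hR) hac (Fin.le_last _))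
      have hik' : i < k := lt_of_le_of_ne hik fun e => hkc (e ▸ hic)
      have hno : ∀ j, c ≤ j → j ≤ Fin.last m → ¬ G.Adj (O.x k) (O.y j) :=
        fun j hj _ hkj => hkc (h.adj_y hka hkj hac hj)
      obtain ⟨i', hi', hadj⟩ := (h.exists_lt_adj_iff hG (Fin.le_last c) hno).1 ⟨_, hik', hic⟩
      exact hno _ (Fin.le_last _) le_rfl (h.adj_x hadj hR hi'.le hkR)
  · rintro i j (⟨hij, hjL⟩ | ⟨hRj, hji⟩) <;> rw [neighborSet_subset_iff] <;> intro y hiy <;>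
      by_contra hjy
    · have hLy : ¬ G.Adj (O.x O.L) (O.y y) := fun hLy => hjy (h.adj_x hiy hLy hij.le hjL)
      have hno : ∀ j, y ≤ j → j ≤ Fin.last m → ¬ G.Adj (O.x O.L) (O.y j) :=
        fun j hj _ hLj => hLy (h.adj_y hL hLj (Fin.zero_le _) hj)
      obtain ⟨i', hi', hadj⟩ :=
        (h.exists_lt_adj_iff hG (Fin.le_last y) hno).1 ⟨i, hij.trans_le hjL, hiy⟩
      exact hno _ (Fin.le_last _) le_rfl (h.adj_x hadj hR hi'.le hLR)
    · have hRy : ¬ G.Adj (O.x O.R) (O.y y) := fun hRy => hjy (h.adj_x hRy hiy hRj hji.le)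
      have hno : ∀ j, 0 ≤ j → j ≤ y → ¬ G.Adj (O.x O.R) (O.y j) :=
        fun j _ hj hRj => hRy (h.adj_y hRj hR hj (Fin.le_last _))
      have hLR' : O.L < O.R :=
        lt_of_le_of_ne hLR fun e => hno 0 le_rfl (Fin.zero_le _) (e ▸ hL)
      obtain ⟨i', hi', hadj⟩ := (h.exists_lt_adj_iff hG (Fin.zero_le y) hno).1 ⟨_, hLR', hL⟩
      exact hRy (h.adj_x hadj hiy hi'.le (hRj.trans hji.le))

theorem revX_x_rev (i : Fin (n + 1)) : O.revX.x i.rev = O.x i := by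
  simp [revX]

theorem revX_isMaximal (i : Fin (n + 1)) : O.revX.IsMaximal i ↔ O.IsMaximal i.rev :=
  ⟨fun h i' => by simpa [revX] using h i'.rev, fun h i' => h i'.rev⟩

/-- A biconvex ordering of a connected graph becomes admissible, if it is not, when the ordering
of one colour class is reversed. -/
theorem IsBiconvex.exists_isAdmissible (h : O.IsBiconvex) (hG : G.Connected) :
    ∃ O' : BipartiteOrdering G (n + 1) (m + 1),
      Set.range O'.x = Set.range O.x ∧ Set.range O'.y = Set.range O.y ∧ O'.IsAdmissible := by
  rcases le_or_gt O.L O.R with hLR | hLR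
  · exact ⟨O, rfl, rfl, h.isAdmissible hG hLR⟩
  · refine ⟨O.revX, Fin.rev_surjective.range_comp O.x, rfl, h.revX.isAdmissible hG ?_⟩
    have h1 : O.revX.L ≤ O.L.rev := csInf_le (Set.toFinite _).bddBelow
      ⟨by rw [revX_x_rev]; exact O.adj_L hG,
        (revX_isMaximal _).2 (by rw [Fin.rev_rev]; exact O.isMaximal_L hG)⟩
    have h2 : O.R.rev ≤ O.revX.R := le_csSup (Set.toFinite _).bddAbove
      ⟨by rw [revX_x_rev]; exact O.adj_R hG,
        (revX_isMaximal _).2 (by rw [Fin.rev_rev]; exact O.isMaximal_R hG)⟩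
    exact h1.trans ((Fin.rev_le_rev.2 hLR.le).trans h2)

end Admissible

end BipartiteOrdering

/-! ### One step of the decomposition -/

namespace BipartiteOrdering

/-- Turns a property that is inherited by smaller indices in `(a, b]` into a threshold. It is used
to see that the isolated vertices of each class form an interval directly after the block; the
threshold `b + 1` occurs when all of them are isolated. -/
theorem exists_forall_iff_lt {N : ℕ} (Q : Fin N → Prop) {a b : ℕ} (hab : a ≤ b)
    (hQ : ∀ i i' : Fin N, a < i' → (i' : ℕ) ≤ i → (i : ℕ) ≤ b → Q i → Q i') :
    ∃ c, a < c ∧ c ≤ b + 1 ∧ ∀ i : Fin N, a < i → (i : ℕ) ≤ b → (Q i ↔ i < c) := by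
  classical
  have hex : ∃ c, a < c ∧ ∀ i : Fin N, c ≤ i → (i : ℕ) ≤ b → ¬ Q i :=
    ⟨b + 1, by omega, fun i h1 h2 => by omega⟩
  refine ⟨Nat.find hex, (Nat.find_spec hex).1, Nat.find_min' hex ⟨by omega, fun i h1 h2 => by omega⟩,
    fun i hai hib => ⟨fun hi => ?_, fun hi => ?_⟩⟩
  · by_contra! h
    exact (Nat.find_spec hex).2 i h hib hi
  · by_contra h
    exact Nat.find_min hex hi ⟨hai, fun i' h1 h2 hi' => h (hQ _ _ hai h1 h2 hi')⟩

variable {V : Type*} {G : SimpleGraph V} {n m : ℕ} {O : BipartiteOrdering G (n + 1) (m + 1)}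

theorem lX_eq {S : Set V} {a b : Fin (n + 1)} (hab : a ≤ b)
    (h : ∀ i, O.x i ∈ S ↔ (a : ℕ) ≤ i ∧ (i : ℕ) ≤ b) : O.lX S = O.x a := by
  have : {i | O.x i ∈ S} = Set.Icc a b := Set.ext h
  rw [lX, this, csInf_Icc hab]

theorem rX_eq {S : Set V} {a b : Fin (n + 1)} (hab : a ≤ b)
    (h : ∀ i, O.x i ∈ S ↔ (a : ℕ) ≤ i ∧ (i : ℕ) ≤ b) : O.rX S = O.x b := by
  have : {i | O.x i ∈ S} = Set.Icc a b := Set.ext h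
  rw [rX, this, csSup_Icc hab]

theorem lY_eq {S : Set V} {a b : Fin (m + 1)} (hab : a ≤ b)
    (h : ∀ i, O.y i ∈ S ↔ (a : ℕ) ≤ i ∧ (i : ℕ) ≤ b) : O.lY S = O.y a :=
  O.swap.lX_eq hab h

theorem rY_eq {S : Set V} {a b : Fin (m + 1)} (hab : a ≤ b)
    (h : ∀ i, O.y i ∈ S ↔ (a : ℕ) ≤ i ∧ (i : ℕ) ≤ b) : O.rY S = O.y b :=
  O.swap.rX_eq hab h

theorem IsAdmissible.adj_left (hO : O.IsAdmissible) {i k : Fin (n + 1)} {a c : Fin (m + 1)}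
    (hic : G.Adj (O.x i) (O.y c)) (hka : G.Adj (O.x k) (O.y a)) (h1 : (O.L : ℕ) ≤ i)
    (h2 : (i : ℕ) ≤ k) (h3 : (k : ℕ) ≤ O.R) (h4 : (a : ℕ) ≤ c) : G.Adj (O.x i) (O.y a) :=
  (hO.strong i k h1 h2 h3 a c h4 hic hka).1

theorem IsAdmissible.adj_right (hO : O.IsAdmissible) {i k : Fin (n + 1)} {a c : Fin (m + 1)}
    (hic : G.Adj (O.x i) (O.y c)) (hka : G.Adj (O.x k) (O.y a)) (h1 : (O.L : ℕ) ≤ i)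
    (h2 : (i : ℕ) ≤ k) (h3 : (k : ℕ) ≤ O.R) (h4 : (a : ℕ) ≤ c) : G.Adj (O.x k) (O.y c) :=
  (hO.strong i k h1 h2 h3 a c h4 hic hka).2

/-- Nestedness lets `x_L` or `x_R` stand in for a vertex outside the core, so common neighbours
found in `G` can be moved into the core. -/
theorem IsAdmissible.exists_core (hO : O.IsAdmissible) (i : Fin (n + 1)) :
    ∃ i', O.L ≤ i' ∧ i' ≤ O.R ∧ G.neighborSet (O.x i) ⊆ G.neighborSet (O.x i') := by
  rcases lt_or_ge i O.L with h | h
  · exact ⟨O.L, le_rfl, hO.L_le_R, hO.nested i _ (.inl ⟨h, le_rfl⟩)⟩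
  rcases lt_or_ge O.R i with h' | h'
  · exact ⟨O.R, hO.L_le_R, le_rfl, hO.nested i _ (.inr ⟨le_rfl, h'⟩)⟩
  · exact ⟨i, h, h', le_rfl⟩

/-- The set `S` consists of the `x i` with `p ≤ i ≤ R` and of the `y j` with `q ≤ j`, and it
induces a subgraph without isolated vertices. -/
structure IsTail (O : BipartiteOrdering G (n + 1) (m + 1)) (S : Set V) (p q : ℕ) : Prop where
  x_mem : ∀ i, O.x i ∈ S ↔ p ≤ i ∧ (i : ℕ) ≤ O.R
  y_mem : ∀ j, O.y j ∈ S ↔ q ≤ j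
  L_le : O.L ≤ p
  exists_y : ∀ i : Fin (n + 1), p ≤ i → (i : ℕ) ≤ O.R → ∃ j : Fin (m + 1), q ≤ j ∧
    G.Adj (O.x i) (O.y j)
  exists_x : ∀ j : Fin (m + 1), q ≤ j → ∃ i : Fin (n + 1), p ≤ i ∧ (i : ℕ) ≤ O.R ∧
    G.Adj (O.x i) (O.y j)

theorem IsTail.eq_empty {S : Set V} {p q : ℕ} (h : O.IsTail S p q) (hp : O.R < p) : S = ∅ := by
  refine Set.eq_empty_of_forall_notMem fun v hv => ?_
  rcases O.cover v with ⟨i, rfl⟩ | ⟨j, rfl⟩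
  · have := (h.x_mem i).1 hv
    omega
  · obtain ⟨i, hi⟩ := h.exists_x j ((h.y_mem j).1 hv)
    omega

/-- The first block of a tail `S` is complete bipartite with classes `x p, …, x p'` and
`y q, …, y q'`; the isolated vertices of the rest are `x (p' + 1), …, x (p'' - 1)` and
`y (q' + 1), …, y (q'' - 1)`, one of these two sets being empty; and the rest is joined to the
block by an edge. -/
structure IsBlock (O : BipartiteOrdering G (n + 1) (m + 1)) (S : Set V) (p p' : Fin (n + 1))
    (q q' : Fin (m + 1)) (p'' q'' : ℕ) : Prop where
  p_le : (p : ℕ) ≤ p'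
  q_le : (q : ℕ) ≤ q'
  p_lt : p' < p''
  q_lt : q' < q''
  le_R : (p' : ℕ) ≤ O.R
  x_mem_K : ∀ i, O.x i ∈ O.blockK S ↔ (p : ℕ) ≤ i ∧ (i : ℕ) ≤ p'
  y_mem_K : ∀ j, O.y j ∈ O.blockK S ↔ (q : ℕ) ≤ j ∧ (j : ℕ) ≤ q'
  x_mem_J : ∀ i, O.x i ∈ O.blockJ S ↔ p' < i ∧ i < p'' ∧ (i : ℕ) ≤ O.R
  y_mem_J : ∀ j, O.y j ∈ O.blockJ S ↔ q' < j ∧ j < q''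
  adj : ∀ (i : Fin (n + 1)) (j : Fin (m + 1)), (p : ℕ) ≤ i → (i : ℕ) ≤ p' → (q : ℕ) ≤ j → (j : ℕ) ≤ q' → G.Adj (O.x i) (O.y j)
  tail : O.IsTail (S \ (O.blockK S ∪ O.blockJ S)) p'' q''
  link : (p'' = p' + 1 ∧ ∀ j : Fin (m + 1), q' < j → (j : ℕ) ≤ q'' → G.Adj (O.x p') (O.y j)) ∨
    (q'' = q' + 1 ∧ (∀ i : Fin (n + 1), p' < i → (i : ℕ) ≤ p'' → (i : ℕ) ≤ O.R → G.Adj (O.x i) (O.y q')) ∧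
      ∀ (i : Fin (n + 1)) (j : Fin (m + 1)), (p : ℕ) ≤ i → (i : ℕ) ≤ p' → q'' ≤ j → ¬ G.Adj (O.x i) (O.y j))

/-- The block ends at the last neighbour `x p'` of `y q` and at the last neighbour `y q'` of `x p`.
Every isolated vertex of the rest has a neighbour in the tail, which must lie in the block;
uncrossing with these edges gives all the claims except the link across the gap, which also needs
the common neighbours of consecutive vertices supplied by connectivity. -/
theorem IsTail.exists_isBlock (hO : O.IsAdmissible) (hG : G.Connected) {S : Set V}
    {p : Fin (n + 1)} {q : ℕ} (h : O.IsTail S p q) (hp : (p : ℕ) ≤ O.R) :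
    ∃ p' q' p'' q'', ∃ hq : q < m + 1, O.IsBlock S p p' ⟨q, hq⟩ q' p'' q'' := by
  have hq : q < m + 1 := by
    obtain ⟨j, hj, -⟩ := h.exists_y p le_rfl hp
    omega
  obtain ⟨q, rfl⟩ : ∃ q' : Fin (m + 1), (q' : ℕ) = q := ⟨⟨q, hq⟩, rfl⟩
  have hLp := h.L_le
  have hm : ∀ j : Fin (m + 1), (j : ℕ) ≤ Fin.last m := fun j => Fin.le_last j
  have hlX : O.lX S = O.x p := lX_eq (b := O.R) hp h.x_mem
  have hlY : O.lY S = O.y q :=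
    lY_eq (b := Fin.last m) (hm q) fun j => (h.y_mem j).trans ⟨fun a => ⟨a, hm j⟩, fun a => a.1⟩
  -- Neither first vertex is isolated in the tail; uncrossing an edge at `x p` and an edge at `y q`
  -- joins them.
  have hpq : G.Adj (O.x p) (O.y q) := by
    obtain ⟨j, hj, hpj⟩ := h.exists_y p le_rfl hp
    obtain ⟨i, hi, hiR, hiq⟩ := h.exists_x q le_rfl
    exact hO.adj_left hpj hiq hLp hi hiR hj
  obtain ⟨p', ⟨hpp', hp'R, hp'q⟩, hp'max⟩ := (Set.toFinite {i : Fin (n + 1) | (p : ℕ) ≤ i ∧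
    (i : ℕ) ≤ O.R ∧ G.Adj (O.x i) (O.y q)}).exists_maximal ⟨p, le_rfl, hp, hpq⟩
  obtain ⟨q', ⟨hqq', hpq'⟩, hq'max⟩ := (Set.toFinite {j : Fin (m + 1) | (q : ℕ) ≤ j ∧
    G.Adj (O.x p) (O.y j)}).exists_maximal ⟨q, le_rfl, hpq⟩
  replace hp'max : ∀ i : Fin (n + 1), (p : ℕ) ≤ i → (i : ℕ) ≤ O.R → G.Adj (O.x i) (O.y q) →
      (i : ℕ) ≤ p' := fun i h1 h2 h3 => (le_total i p').elim id fun h' => hp'max ⟨h1, h2, h3⟩ h'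
  replace hq'max : ∀ j : Fin (m + 1), (q : ℕ) ≤ j → G.Adj (O.x p) (O.y j) → (j : ℕ) ≤ q' :=
    fun j h1 h2 => (le_total j q').elim id fun h' => hq'max ⟨h1, h2⟩ h'
  have hiq : ∀ i : Fin (n + 1), (p : ℕ) ≤ i → (i : ℕ) ≤ p' → G.Adj (O.x i) (O.y q) :=
    fun i h1 h2 => hO.biconvex.adj_x hpq hp'q h1 h2
  have hpj : ∀ j : Fin (m + 1), (q : ℕ) ≤ j → (j : ℕ) ≤ q' → G.Adj (O.x p) (O.y j) :=
    fun j h1 h2 => hO.biconvex.adj_y hpq hpq' h1 h2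
  have hKX : ∀ i, O.x i ∈ O.blockK S ↔ (p : ℕ) ≤ i ∧ (i : ℕ) ≤ p' := by
    intro i
    simp only [blockK, Set.mem_ofPred_eq, hlX, hlY, h.x_mem, O.not_adj_x, false_or]
    exact ⟨fun ⟨h1, h2⟩ => ⟨h1.1, hp'max i h1.1 h1.2 h2.symm⟩,
      fun ⟨h1, h2⟩ => ⟨⟨h1, by omega⟩, (hiq i h1 h2).symm⟩⟩
  have hKY : ∀ j, O.y j ∈ O.blockK S ↔ (q : ℕ) ≤ j ∧ (j : ℕ) ≤ q' := by
    intro j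
    simp only [blockK, Set.mem_ofPred_eq, hlX, hlY, h.y_mem, O.not_adj_y, or_false]
    exact ⟨fun ⟨h1, h2⟩ => ⟨h1, hq'max j h1 h2⟩, fun ⟨h1, h2⟩ => ⟨h1, hpj j h1 h2⟩⟩
  -- the isolated vertices of the rest
  let JX : Fin (n + 1) → Prop := fun i => ∀ j : Fin (m + 1), q' < j → ¬ G.Adj (O.x i) (O.y j)
  let JY : Fin (m + 1) → Prop := fun j => ∀ i : Fin (n + 1), p' < i → (i : ℕ) ≤ O.R →
    ¬ G.Adj (O.x i) (O.y j)
  have hJX : ∀ i : Fin (n + 1), p' < i → (i : ℕ) ≤ O.R → JX i →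
      ∃ j : Fin (m + 1), (q : ℕ) ≤ j ∧ (j : ℕ) ≤ q' ∧ G.Adj (O.x i) (O.y j) := by
    intro i h1 h2 hi
    obtain ⟨j, hj, hij⟩ := h.exists_y i (by omega) h2
    exact ⟨j, hj, not_lt.1 fun h' => hi j h' hij, hij⟩
  have hJY : ∀ j : Fin (m + 1), q' < j → JY j →
      ∃ i : Fin (n + 1), (p : ℕ) ≤ i ∧ (i : ℕ) ≤ p' ∧ G.Adj (O.x i) (O.y j) := by
    intro j h1 hj
    obtain ⟨i, hi, hiR, hij⟩ := h.exists_x j (by omega)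
    exact ⟨i, hi, not_lt.1 fun h' => hj i h' hiR hij, hij⟩
  obtain ⟨p'', hpp'', hp''R, hp''⟩ := exists_forall_iff_lt JX hp'R (by
    intro i i' h1 h2 h3 hi j hj hadj
    obtain ⟨j', -, hj', hij'⟩ := hJX i (lt_of_lt_of_le h1 h2) h3 hi
    exact hi j hj (hO.adj_right hadj hij' (by omega) h2 h3 (by omega)))
  obtain ⟨q'', hqq'', hq''m, hq''⟩ := exists_forall_iff_lt JY (hm q') (by
    intro j j' h1 h2 h3 hj i hi hiR hadj
    obtain ⟨i', hi'p, hi', hij'⟩ := hJY j (lt_of_lt_of_le h1 h2) hj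
    exact hj i hi hiR (hO.adj_right hij' hadj (by omega) (by omega) hiR h2))
  -- Isolated vertices in both classes would have neighbours in the block along crossing edges, and
  -- uncrossing these would make them adjacent.
  have hJXY : ∀ i j, p' < i → (i : ℕ) ≤ O.R → JX i → q' < j → JY j → False := by
    intro i j h1 h2 hi h3 hj
    obtain ⟨j', -, hj', hij'⟩ := hJX i h1 h2 hi
    obtain ⟨i', hi'p, hi', hij''⟩ := hJY j h3 hj
    exact hi j h3 (hO.adj_right hij'' hij' (by omega) (by omega) h2 (by omega))
  have hJX' : ∀ i, O.x i ∈ O.blockJ S ↔ p' < i ∧ i < p'' ∧ (i : ℕ) ≤ O.R := by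
    intro i
    constructor
    · rintro ⟨⟨h1, h2⟩, h3⟩
      rw [h.x_mem] at h1
      rw [hKX] at h2
      have h4 : p' < i := by rw [Fin.lt_def]; omega
      refine ⟨h4, (hp'' i h4 h1.2).1 fun j hj => h3 _ ⟨(h.y_mem j).2 ?_, ?_⟩, h1.2⟩
      · omega
      · rw [hKY]
        omega
    · rintro ⟨h1, h2, h3⟩
      refine ⟨⟨(h.x_mem i).2 ?_, ?_⟩, ?_⟩
      · omega
      · rw [hKX]
        omega
      · rintro w ⟨hw, hwK⟩ hadj
        obtain ⟨j, rfl⟩ := O.exists_y_of_adj_x hadj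
        rw [h.y_mem] at hw
        rw [hKY] at hwK
        exact (hp'' i h1 h3).2 h2 j (by rw [Fin.lt_def]; omega) hadj
  have hJY' : ∀ j, O.y j ∈ O.blockJ S ↔ q' < j ∧ j < q'' := by
    intro j
    constructor
    · rintro ⟨⟨h1, h2⟩, h3⟩
      rw [h.y_mem] at h1
      rw [hKY] at h2
      have h4 : q' < j := by rw [Fin.lt_def]; omega
      refine ⟨h4, (hq'' j h4 (hm j)).1 fun i hi hiR hadj =>
        h3 _ ⟨(h.x_mem i).2 ?_, ?_⟩ hadj.symm⟩
      · omega
      · rw [hKX]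
        omega
    · rintro ⟨h1, h2⟩
      refine ⟨⟨(h.y_mem j).2 ?_, ?_⟩, ?_⟩
      · omega
      · rw [hKY]
        omega
      · rintro w ⟨hw, hwK⟩ hadj
        obtain ⟨i, rfl⟩ := O.exists_x_of_adj_y hadj.symm
        rw [h.x_mem] at hw
        rw [hKX] at hwK
        exact (hq'' j h1 (hm j)).2 h2 i (by rw [Fin.lt_def]; omega) hw.2 hadj.symm
  refine ⟨p', q', p'', q'', q.2, hpp', hqq', hpp'', hqq'', hp'R, hKX, hKY, hJX', hJY', ?_, ?_, ?_⟩
  · intro i j h1 h2 h3 h4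
    exact hO.adj_right (hpj j h3 h4) (hiq i h1 h2) hLp h1 (by omega) h3
  · refine ⟨?_, ?_, by omega, ?_, ?_⟩
    · intro i
      simp only [Set.mem_sdiff, Set.mem_union, hKX, hJX', h.x_mem]
      rw [Fin.lt_def]
      omega
    · intro j
      simp only [Set.mem_sdiff, Set.mem_union, hKY, hJY', h.y_mem]
      rw [Fin.lt_def]
      omega
    · intro i h1 h2
      have hi := mt (hp'' i (by omega) h2).1 (by omega)
      simp only [JX, not_forall, not_not] at hi
      obtain ⟨j, hj, hij⟩ := hi
      refine ⟨j, ?_, hij⟩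
      by_contra! hj'
      exact (hq'' j hj (hm j)).2 hj' i (by rw [Fin.lt_def]; omega) h2 hij
    · intro j h1
      have hj := mt (hq'' j (by omega) (hm j)).1 (by omega)
      simp only [JY, not_forall, not_not] at hj
      obtain ⟨i, hi, hiR, hij⟩ := hj
      refine ⟨i, ?_, hiR, hij⟩
      by_contra! hi'
      exact (hp'' i hi hiR).2 hi' j (by rw [Fin.lt_def]; omega) hij
  · have hp'j : ∀ (i : Fin (n + 1)) (j : Fin (m + 1)), (O.L : ℕ) ≤ i → (i : ℕ) ≤ p' → (q : ℕ) ≤ j → G.Adj (O.x i) (O.y j) →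
        G.Adj (O.x p') (O.y j) :=
      fun i j h1 h2 h3 hij => hO.adj_right hij hp'q h1 h2 hp'R h3
    have hq'i : ∀ (i : Fin (n + 1)) (j : Fin (m + 1)), (p : ℕ) ≤ i → (i : ℕ) ≤ O.R → (j : ℕ) ≤ q' → G.Adj (O.x i) (O.y j) →
        G.Adj (O.x i) (O.y q') :=
      fun i j h1 h2 h3 hij => hO.adj_right hpq' hij hLp h1 h2 h3
    rcases (show p' + 1 ≤ p'' from hpp'').lt_or_eq with hlt | heq
    · -- isolated vertices in the first class
      right
      have hlast : ∃ i : Fin (n + 1), (i : ℕ) = p'' - 1 := ⟨⟨p'' - 1, by omega⟩, rfl⟩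
      obtain ⟨i₀, hi₀⟩ := hlast
      have hi₀J : JX i₀ := (hp'' i₀ (by omega) (by omega)).2 (by omega)
      refine ⟨?_, ?_, ?_⟩
      · by_contra hne
        obtain ⟨j, hj⟩ : ∃ j : Fin (m + 1), (j : ℕ) = q' + 1 := ⟨⟨q' + 1, by simp at hq''m; omega⟩, rfl⟩
        exact hJXY i₀ j (by rw [Fin.lt_def]; omega) (by omega) hi₀J (by rw [Fin.lt_def]; omega)
          ((hq'' j (by omega) (hm j)).2 (by omega))
      · intro i h1 h2 h3
        rcases h2.lt_or_eq with h2 | h2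
        · obtain ⟨j, -, hj, hij⟩ := hJX i h1 h3 ((hp'' i h1 h3).2 h2)
          exact hq'i i j (by omega) h3 hj hij
        -- The first vertex after the isolated ones shares a neighbour with the last isolated vertex
        -- `x i₀`, and that neighbour is not beyond `y q'`.
        · obtain ⟨j, hj1, hj2⟩ := hO.biconvex.exists_common_neighbor_x hG (i := i₀) (i' := i)
            (by omega)
          exact hq'i i j (by omega) h3 (not_lt.1 fun h' => hi₀J j h' hj1) hj2
      · intro i j h1 h2 h3 hij
        obtain ⟨j', -, hj', hij'⟩ := hJX i₀ (by rw [Fin.lt_def]; omega) (by omega) hi₀J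
        exact hi₀J j (by rw [Fin.lt_def]; omega)
          (hO.adj_right hij hij' (by omega) (by omega) (by omega) (by omega))
    -- Now `X` has no isolated vertices. The condition is vacuous for `q'' = m + 1`, so when `Y` is
    -- exhausted the first alternative is taken.
    · by_cases hlink : ∀ j : Fin (m + 1), (j : ℕ) = q'' → G.Adj (O.x p') (O.y j)
      · refine .inl ⟨heq.symm, fun j h1 h2 => ?_⟩
        rcases h2.lt_or_eq with h2 | h2
        · obtain ⟨i, hi, hi', hij⟩ := hJY j h1 ((hq'' j h1 (hm j)).2 h2)
          exact hp'j i j (by omega) hi' (by omega) hij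
        · exact hlink j h2
      · right
        push Not at hlink
        obtain ⟨j₀, hj₀, hno⟩ := hlink
        -- If `Y` had isolated vertices, the last of them would share a neighbour with `y q''`. Its
        -- replacement in the core has index at most `p'`, and uncrossing makes `x p'` adjacent to
        -- `y q''`.
        have hq1 : q'' = q' + 1 := by
          by_contra hne
          obtain ⟨j₁, hj₁⟩ : ∃ j : Fin (m + 1), (j : ℕ) = q'' - 1 := ⟨⟨q'' - 1, by omega⟩, rfl⟩
          obtain ⟨i, hi1, hi2⟩ := hO.biconvex.exists_common_neighbor_y hG (j := j₁) (j' := j₀)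
            (by omega)
          obtain ⟨i', hLi', hiR', hN⟩ := hO.exists_core i
          have hi'p' : (i' : ℕ) ≤ p' := not_lt.1 fun h' =>
            (hq'' j₁ (by omega) (hm _)).2 (by omega) i' h' hiR' (hN hi1)
          exact hno (hp'j i' j₀ hLi' hi'p' (by omega) (hN hi2))
        refine ⟨hq1, ?_, ?_⟩
        · intro i h1 h2 h3
          obtain ⟨j, hj1, hj2⟩ := hO.biconvex.exists_common_neighbor_x hG (i := p') (i' := i)
            (by rw [Fin.lt_def] at h1; omega)
          refine hq'i i j (by omega) h3 (not_lt.1 fun h' => hno ?_) hj2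
          exact hO.biconvex.adj_y hp'q hj1 (by rw [Fin.le_def]; omega) (by rw [Fin.le_def]; omega)
        · intro i j h1 h2 h3 hij
          refine hno (hO.biconvex.adj_y hp'q (hp'j i j (by omega) h2 (by omega) hij) ?_ ?_) <;>
            rw [Fin.le_def] <;> omega

end BipartiteOrdering

namespace BipartiteOrdering

variable {V : Type*} {G : SimpleGraph V} {n m : ℕ} {O : BipartiteOrdering G (n + 1) (m + 1)}

/-! ### The whole decomposition: termination, exits and entries -/

section Blocks

theorem IsAdmissible.isTail_remaining_zero (hO : O.IsAdmissible) (hG : G.Connected) :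
    O.IsTail (O.remaining 0) O.L 0 := by
  refine ⟨fun i => ?_, fun j => ?_, le_rfl, fun i _ _ => ?_, fun j _ => ?_⟩
  · constructor
    · rintro (⟨i', h1, h2, h⟩ | ⟨j, h⟩)
      · rw [← O.x_injective h]
        exact ⟨h1, h2⟩
      · exact (O.x_ne_y _ _ h.symm).elim
    · rintro ⟨h1, h2⟩
      exact .inl ⟨i, h1, h2, rfl⟩
  · exact ⟨fun _ => Nat.zero_le _, fun _ => .inr ⟨j, rfl⟩⟩
  · obtain ⟨j, hj⟩ := O.exists_adj_x hG i
    exact ⟨j, Nat.zero_le _, hj⟩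
  · obtain ⟨i, hi⟩ := O.exists_adj_y hG j
    obtain ⟨i', h1, h2, h3⟩ := hO.exists_core i
    exact ⟨i', h1, h2, h3 hi⟩

/-- Every block uses up a vertex of `X`, so the left end of the tail grows with the number of steps
until it passes `R`, after which nothing is left to delete. This bound gives termination. -/
theorem IsAdmissible.exists_isTail_remaining (hO : O.IsAdmissible) (hG : G.Connected) (i : ℕ) :
    ∃ p q, O.IsTail (O.remaining i) p q ∧ (i ≤ p ∨ O.R < p) := by
  induction i with
  | zero => exact ⟨_, _, hO.isTail_remaining_zero hG, .inl (Nat.zero_le _)⟩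
  | succ i ih =>
    obtain ⟨p, q, h, hp⟩ := ih
    rcases lt_or_ge (O.R : ℕ) p with hR | hR
    · refine ⟨p, q, ?_, .inr hR⟩
      have h0 := h.eq_empty hR
      rw [remaining, h0, Set.empty_sdiff, ← h0]
      exact h
    · obtain ⟨p, rfl⟩ : ∃ p' : Fin (n + 1), (p' : ℕ) = p := ⟨⟨p, by omega⟩, rfl⟩
      obtain ⟨p', q', p'', q'', _, hB⟩ := h.exists_isBlock hO hG hR
      refine ⟨p'', q'', hB.tail, .inl ?_⟩
      have := hB.p_le
      have := hB.p_lt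
      omega

theorem IsAdmissible.exists_remaining_eq_empty (hO : O.IsAdmissible) (hG : G.Connected) :
    ∃ i, O.remaining i = ∅ := by
  obtain ⟨p, q, h, hp⟩ := hO.exists_isTail_remaining hG (O.R + 1)
  exact ⟨_, h.eq_empty (by omega)⟩

theorem IsAdmissible.remaining_k (hO : O.IsAdmissible) (hG : G.Connected) :
    O.remaining O.k = ∅ :=
  Nat.sInf_mem (hO.exists_remaining_eq_empty hG)

theorem remaining_nonempty {i : ℕ} (hi : i < O.k) : (O.remaining i).Nonempty :=
  Set.nonempty_iff_ne_empty.2 (Nat.notMem_of_lt_sInf hi)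

theorem IsAdmissible.k_pos (hO : O.IsAdmissible) (hG : G.Connected) : 0 < O.k := by
  by_contra! h
  have h0 := hO.remaining_k hG
  rw [Nat.le_zero.1 h] at h0
  have : O.y 0 ∈ O.remaining 0 := .inr ⟨0, rfl⟩
  simp [h0] at this

theorem IsTail.le_R {S : Set V} {p q : ℕ} (h : O.IsTail S p q) (hS : S.Nonempty) : p ≤ O.R := by
  by_contra! hp
  exact hS.ne_empty (h.eq_empty hp)

theorem IsAdmissible.exists_isBlock (hO : O.IsAdmissible) (hG : G.Connected) {i : ℕ}
    (hi : i < O.k) : ∃ p p' q q' p'' q'', O.IsBlock (O.remaining i) p p' q q' p'' q'' := by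
  obtain ⟨p, q, h, -⟩ := hO.exists_isTail_remaining hG i
  have hR := h.le_R (remaining_nonempty hi)
  obtain ⟨p, rfl⟩ : ∃ p' : Fin (n + 1), (p' : ℕ) = p := ⟨⟨p, by omega⟩, rfl⟩
  obtain ⟨p', q', p'', q'', _, hB⟩ := h.exists_isBlock hO hG hR
  exact ⟨_, _, _, _, _, _, hB⟩

theorem IsAdmissible.exists_isBlock_succ (hO : O.IsAdmissible) (hG : G.Connected) {i : ℕ}
    (hi : i + 1 < O.k) : ∃ p p' q q', ∃ p₁ p₁' : Fin (n + 1), ∃ q₁ q₁' : Fin (m + 1), ∃ p₂ q₂,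
      O.IsBlock (O.remaining i) p p' q q' p₁ q₁ ∧
        O.IsBlock (O.remaining (i + 1)) p₁ p₁' q₁ q₁' p₂ q₂ := by
  obtain ⟨p, p', q, q', p'', q'', hB⟩ := hO.exists_isBlock hG (Nat.lt_of_succ_lt hi)
  have h : O.IsTail (O.remaining (i + 1)) p'' q'' := hB.tail
  have hR := h.le_R (remaining_nonempty hi)
  obtain ⟨p₁, rfl⟩ : ∃ p' : Fin (n + 1), (p' : ℕ) = p'' := ⟨⟨p'', by omega⟩, rfl⟩
  obtain ⟨p₁', q₁', p₂, q₂, hq, hB'⟩ := h.exists_isBlock hO hG hR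
  exact ⟨p, p', q, q', p₁, p₁', ⟨q'', hq⟩, q₁', p₂, q₂, hB, hB'⟩

theorem IsBlock.lX {S : Set V} {p p' : Fin (n + 1)} {q q' : Fin (m + 1)} {p'' q'' : ℕ}
    (h : O.IsBlock S p p' q q' p'' q'') : O.lX (O.blockK S) = O.x p :=
  lX_eq h.p_le h.x_mem_K

theorem IsBlock.rX {S : Set V} {p p' : Fin (n + 1)} {q q' : Fin (m + 1)} {p'' q'' : ℕ}
    (h : O.IsBlock S p p' q q' p'' q'') : O.rX (O.blockK S) = O.x p' :=
  rX_eq h.p_le h.x_mem_K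

theorem IsBlock.lY {S : Set V} {p p' : Fin (n + 1)} {q q' : Fin (m + 1)} {p'' q'' : ℕ}
    (h : O.IsBlock S p p' q q' p'' q'') : O.lY (O.blockK S) = O.y q :=
  lY_eq h.q_le h.y_mem_K

theorem IsBlock.rY {S : Set V} {p p' : Fin (n + 1)} {q q' : Fin (m + 1)} {p'' q'' : ℕ}
    (h : O.IsBlock S p p' q q' p'' q'') : O.rY (O.blockK S) = O.y q' :=
  rY_eq h.q_le h.y_mem_K

theorem remaining_succ_subset (O : BipartiteOrdering G (n + 1) (m + 1)) (i : ℕ) :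
    O.remaining (i + 1) ⊆ O.remaining i := Set.sdiff_subset

theorem remaining_antitone (O : BipartiteOrdering G (n + 1) (m + 1)) : Antitone O.remaining :=
  antitone_nat_of_succ_le O.remaining_succ_subset

theorem K_subset_remaining (O : BipartiteOrdering G (n + 1) (m + 1)) (i : ℕ) :
    O.K i ⊆ O.remaining i := fun _ h => h.1

theorem notMem_remaining_of_mem_K {i j : ℕ} {v : V} (hv : v ∈ O.K i) (hij : i < j) :
    v ∉ O.remaining j := fun h => (O.remaining_antitone hij h).2 (.inl hv)

theorem exists_mem_K_or_mem_J (hO : O.IsAdmissible) (hG : G.Connected) {v : V}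
    (hv : v ∈ O.remaining 0) : ∃ j < O.k, v ∈ O.K j ∨ v ∈ O.J j := by
  have key : ∀ i, v ∈ O.remaining i ∨ ∃ j < i, v ∈ O.K j ∨ v ∈ O.J j := by
    intro i
    induction i with
    | zero => exact .inl hv
    | succ i ih =>
      rcases ih with h | ⟨j, hj, h⟩
      · by_cases h' : v ∈ O.K i ∨ v ∈ O.J i
        · exact .inr ⟨i, by omega, h'⟩
        · exact .inl ⟨h, h'⟩
      · exact .inr ⟨j, by omega, h⟩
  rcases key O.k with h | h
  · simp [hO.remaining_k hG] at h
  · exact h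

/-- A block is complete bipartite. -/
theorem IsAdmissible.adj_of_mem_K (hO : O.IsAdmissible) (hG : G.Connected) {i : ℕ} (hi : i < O.k)
    {a : Fin (n + 1)} {b : Fin (m + 1)} (ha : O.x a ∈ O.K i) (hb : O.y b ∈ O.K i) :
    G.Adj (O.x a) (O.y b) := by
  obtain ⟨p, p', q, q', p'', q'', h⟩ := hO.exists_isBlock hG hi
  have ha' := (h.x_mem_K a).1 ha
  have hb' := (h.y_mem_K b).1 hb
  exact h.adj a b ha'.1 ha'.2 hb'.1 hb'.2

theorem lX_mem_K (hO : O.IsAdmissible) (hG : G.Connected) {i : ℕ} (hi : i < O.k) :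
    O.lX (O.K i) ∈ O.K i := by
  obtain ⟨p, p', q, q', p'', q'', h⟩ := hO.exists_isBlock hG hi
  rw [K, h.lX, h.x_mem_K]
  exact ⟨le_rfl, h.p_le⟩

theorem rX_mem_K (hO : O.IsAdmissible) (hG : G.Connected) {i : ℕ} (hi : i < O.k) :
    O.rX (O.K i) ∈ O.K i := by
  obtain ⟨p, p', q, q', p'', q'', h⟩ := hO.exists_isBlock hG hi
  rw [K, h.rX, h.x_mem_K]
  exact ⟨h.p_le, le_rfl⟩

theorem lY_mem_K (hO : O.IsAdmissible) (hG : G.Connected) {i : ℕ} (hi : i < O.k) :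
    O.lY (O.K i) ∈ O.K i := by
  obtain ⟨p, p', q, q', p'', q'', h⟩ := hO.exists_isBlock hG hi
  rw [K, h.lY, h.y_mem_K]
  exact ⟨le_rfl, h.q_le⟩

theorem rY_mem_K (hO : O.IsAdmissible) (hG : G.Connected) {i : ℕ} (hi : i < O.k) :
    O.rY (O.K i) ∈ O.K i := by
  obtain ⟨p, p', q, q', p'', q'', h⟩ := hO.exists_isBlock hG hi
  rw [K, h.rY, h.y_mem_K]
  exact ⟨h.q_le, le_rfl⟩

theorem eq_of_lX_eq_rX {S : Set V} (hS : O.lX S = O.rX S) {a : Fin (n + 1)} (ha : O.x a ∈ S) :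
    O.x a = O.lX S := by
  have hle : sInf {i | O.x i ∈ S} ≤ a := csInf_le (Set.toFinite _).bddBelow ha
  have hge : a ≤ sSup {i | O.x i ∈ S} := le_csSup (Set.toFinite _).bddAbove ha
  rw [← O.x_injective hS] at hge
  rw [lX, le_antisymm hge hle]

theorem eq_of_lY_eq_rY {S : Set V} (hS : O.lY S = O.rY S) {a : Fin (m + 1)} (ha : O.y a ∈ S) :
    O.y a = O.lY S :=
  O.swap.eq_of_lX_eq_rX hS ha

theorem exit_eq (O : BipartiteOrdering G (n + 1) (m + 1)) (i : ℕ) :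
    O.exit i = O.rX (O.K i) ∨ O.exit i = O.rY (O.K i) := by
  rw [exit]
  split_ifs <;> simp

theorem exit_last (O : BipartiteOrdering G (n + 1) (m + 1)) {i : ℕ} (hi : i + 1 = O.k) :
    O.exit i = O.rX (O.K i) := by
  rw [exit, if_pos (.inl hi)]

theorem exit_mem_K (hO : O.IsAdmissible) (hG : G.Connected) {i : ℕ} (hi : i < O.k) :
    O.exit i ∈ O.K i := by
  rcases O.exit_eq i with h | h <;> rw [h]
  · exact rX_mem_K hO hG hi
  · exact rY_mem_K hO hG hi

theorem entry_eq (O : BipartiteOrdering G (n + 1) (m + 1)) (i : ℕ) :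
    O.entry i = O.lX (O.K (i + 1)) ∨ O.entry i = O.lY (O.K (i + 1)) := by
  rw [entry]
  split_ifs <;> simp

theorem entry_mem_K (hO : O.IsAdmissible) (hG : G.Connected) {i : ℕ} (hi : i + 1 < O.k) :
    O.entry i ∈ O.K (i + 1) := by
  rcases O.entry_eq i with h | h <;> rw [h]
  · exact lX_mem_K hO hG hi
  · exact lY_mem_K hO hG hi

/-- The vertex at which the path leaves a block is adjacent to the vertex at which it enters the
next one, and to the isolated vertices that are deleted with the block. -/
theorem IsAdmissible.adj_exit (hO : O.IsAdmissible) (hG : G.Connected) {i : ℕ}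
    (hi : i + 1 < O.k) :
    G.Adj (O.exit i) (O.entry i) ∧ ∀ v ∈ O.J i, G.Adj (O.exit i) v := by
  obtain ⟨p, p', q, q', p₁, p₁', q₁, q₁', p₂, q₂, h, h'⟩ := hO.exists_isBlock_succ hG hi
  have hx := h.x_mem_J
  have hy := h.y_mem_J
  -- The alternatives match the case distinction of the algorithm: in the first, `x p'` and `y q₁`
  -- form an `XY`-edge; in the second, `h3` excludes such edges.
  rcases h.link with ⟨h1, h2⟩ | ⟨h1, h2, h3⟩
  · have hl : O.LinkedXY i := ⟨p', q₁, (h.x_mem_K _).2 ⟨h.p_le, le_rfl⟩,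
      (h'.y_mem_K _).2 ⟨le_rfl, h'.q_le⟩, h2 _ h.q_lt le_rfl⟩
    rw [exit, entry, if_pos (.inr hl), if_pos hl, K, K, h.rX, h'.lY]
    refine ⟨h2 _ h.q_lt le_rfl, fun v hv => ?_⟩
    rcases O.cover v with ⟨a, rfl⟩ | ⟨b, rfl⟩
    · have := (hx a).1 hv
      omega
    · have := (hy b).1 hv
      exact h2 _ this.1 this.2.le
  · have hl : ¬ O.LinkedXY i := fun ⟨a, b, ha, hb, hab⟩ => by
      rw [K, h.x_mem_K] at ha
      rw [K, h'.y_mem_K] at hb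
      exact h3 a b ha.1 ha.2 hb.1 hab
    have hR : (p₁ : ℕ) ≤ O.R := h'.p_le.trans h'.le_R
    rw [exit, entry, if_neg (by simp [hl, hi.ne]), if_neg hl, K, K, h.rY, h'.lX]
    refine ⟨(h2 _ h.p_lt le_rfl hR).symm, fun v hv => ?_⟩
    rcases O.cover v with ⟨a, rfl⟩ | ⟨b, rfl⟩
    · have := (hx a).1 hv
      exact (h2 _ this.1 this.2.1.le this.2.2).symm
    · have := (hy b).1 hv
      rw [Fin.lt_def] at this
      omega

theorem IsAdmissible.neighborSet_zero_subset (hO : O.IsAdmissible) :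
    G.neighborSet (O.x 0) ⊆ G.neighborSet (O.x O.L) := by
  rcases (Fin.zero_le O.L).eq_or_lt with h | h
  · rw [← h]
  · exact hO.nested _ _ (.inl ⟨h, le_rfl⟩)

theorem IsAdmissible.neighborSet_last_subset (hO : O.IsAdmissible) :
    G.neighborSet (O.x (Fin.last n)) ⊆ G.neighborSet (O.x O.R) := by
  rcases (Fin.le_last O.R).eq_or_lt with h | h
  · rw [← h]
  · exact hO.nested _ _ (.inr ⟨le_rfl, h⟩)

theorem IsAdmissible.mem_K_zero (hO : O.IsAdmissible) (hG : G.Connected) {b : Fin (m + 1)}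
    (hb : G.Adj (O.x 0) (O.y b)) : O.y b ∈ O.K 0 := by
  refine ⟨.inr ⟨b, rfl⟩, .inl ?_⟩
  rw [lX_eq hO.L_le_R (hO.isTail_remaining_zero hG).x_mem]
  exact hO.neighborSet_zero_subset hb

/-- The last vertex of `X` in the last block sees the neighbours of the last vertex of `X` and the
isolated vertices in `Y`, while the isolated vertices in `X` see the neighbours of the last vertex
of `X`. -/
theorem IsAdmissible.adj_exit_last (hO : O.IsAdmissible) (hG : G.Connected) {i : ℕ}
    (hi : i + 1 = O.k) :
    (∀ v, G.Adj (O.x (Fin.last n)) v → G.Adj (O.exit i) v) ∧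
      (∀ b, O.y b ∈ O.J i → G.Adj (O.exit i) (O.y b)) ∧
      ∀ a, O.x a ∈ O.J i → ∀ v, G.Adj (O.x (Fin.last n)) v → G.Adj (O.x a) v := by
  obtain ⟨p, p', q, q', p'', q'', h⟩ := hO.exists_isBlock hG (i := i) (by omega)
  obtain ⟨pt, qt, ht, -⟩ := hO.exists_isTail_remaining hG i
  have hL : (O.L : ℕ) ≤ p :=
    ht.L_le.trans ((ht.x_mem p).1 ((h.x_mem_K p).2 ⟨le_rfl, h.p_le⟩).1).1
  have hpp := h.p_le
  have hqq := h.q_le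
  -- A core vertex adjacent to the last vertex of `Y` sees all neighbours of the last vertex of `X`:
  -- these are neighbours of `x_R`, and the edges uncross. It remains to find edges to the last
  -- vertex of `Y`.
  have hRlast : ∀ c : Fin (n + 1), (O.L : ℕ) ≤ c → (c : ℕ) ≤ O.R →
      G.Adj (O.x c) (O.y (Fin.last m)) → ∀ v, G.Adj (O.x (Fin.last n)) v → G.Adj (O.x c) v := by
    intro c h1 h2 hc v hv
    obtain ⟨b, rfl⟩ := O.exists_y_of_adj_x hv
    exact hO.adj_left hc (hO.neighborSet_last_subset hv) h1 h2 le_rfl (Fin.le_last b)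
  have hq'' : m < q'' := by
    by_contra! hle
    have hmem := (h.tail.y_mem (Fin.last m)).2 hle
    have hk := hO.remaining_k hG
    rw [← hi] at hk
    change O.y (Fin.last m) ∈ O.remaining (i + 1) at hmem
    simp [hk] at hmem
  have hR := h.le_R
  have hq'm := q'.2
  rw [O.exit_last hi, K, h.rX]
  refine ⟨hRlast p' (by omega) h.le_R ?_, fun b hb => ?_, fun a ha => ?_⟩
  · by_cases hm : m ≤ q'
    · exact h.adj _ _ hpp le_rfl (by simp only [Fin.val_last]; omega) hm
    · rcases h.link with ⟨-, h2⟩ | ⟨h1, -⟩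
      · exact h2 _ (by rw [Fin.lt_def, Fin.val_last]; omega) (by rw [Fin.val_last]; omega)
      · omega
  · have hb' := (h.y_mem_J b).1 hb
    rcases h.link with ⟨-, h2⟩ | ⟨h1, -⟩
    · exact h2 _ hb'.1 hb'.2.le
    · rw [Fin.lt_def] at hb'
      omega
  · have ha' := (h.x_mem_J a).1 ha
    rw [Fin.lt_def] at ha'
    rcases h.link with ⟨h1, -⟩ | ⟨h1, h2, -⟩
    · omega
    · refine hRlast a (by omega) ha'.2.2 ?_
      have : q' = Fin.last m := by ext; rw [Fin.val_last]; omega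
      rw [← this]
      exact h2 a ha'.1 ha'.2.1.le ha'.2.2

end Blocks

end BipartiteOrdering

namespace BipartiteOrdering

variable {V : Type*} {G : SimpleGraph V} {n m : ℕ} {O : BipartiteOrdering G (n + 1) (m + 1)}

/-! ### The path built by the algorithm -/

section Loop

theorem IsAdmissible.exists_isPathIn (hO : O.IsAdmissible) (hG : G.Connected) {i : ℕ}
    (hi : i < O.k) {a b : V} (ha : a ∈ O.K i) (hb : b ∈ O.K i) :
    ∃ Q, IsPathIn G (O.K i) a b Q := by
  by_cases hab : a = b
  · subst hab
    exact ⟨[a], by simpa [IsPathIn] using ha⟩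
  obtain ⟨c, hx⟩ : ∃ c, O.x c ∈ O.K i := ⟨_, lX_mem_K hO hG hi⟩
  obtain ⟨d, hy⟩ : ∃ d, O.y d ∈ O.K i := ⟨_, lY_mem_K hO hG hi⟩
  have hadj := @IsAdmissible.adj_of_mem_K _ _ _ _ _ hO hG i hi
  rcases O.cover a with ⟨a, rfl⟩ | ⟨a, rfl⟩ <;> rcases O.cover b with ⟨b, rfl⟩ | ⟨b, rfl⟩
  · exact ⟨[O.x a, O.y d, O.x b], by
      simp [IsPathIn, ha, hb, hy, hab, hadj ha hy, (hadj hb hy).symm, (hadj ha hy).ne,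
        (hadj hb hy).ne']⟩
  · exact ⟨[O.x a, O.y b], by simp [IsPathIn, ha, hb, hab, hadj ha hb]⟩
  · exact ⟨[O.y a, O.x b], by simp [IsPathIn, ha, hb, hab, (hadj hb ha).symm]⟩
  · exact ⟨[O.y a, O.x c, O.y b], by
      simp [IsPathIn, ha, hb, hx, hab, hadj hx hb, (hadj hx ha).symm, (hadj hx ha).ne',
        (hadj hx hb).ne]⟩

/-- An edge of a block dominates the block. -/
theorem IsAdmissible.exists_adj_of_mem_K (hO : O.IsAdmissible) (hG : G.Connected) {i : ℕ}
    (hi : i < O.k) {P : List V} {c d : V} (hc : c ∈ P) (hd : d ∈ P) (hcK : c ∈ O.K i)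
    (hdK : d ∈ O.K i) (hcd : G.Adj c d) {w : V} (hw : w ∈ O.K i) : ∃ z ∈ P, G.Adj z w := by
  have hadj := @IsAdmissible.adj_of_mem_K _ _ _ _ _ hO hG i hi
  rcases O.cover c with ⟨c, rfl⟩ | ⟨c, rfl⟩
  · obtain ⟨d, rfl⟩ := O.exists_y_of_adj_x hcd
    rcases O.cover w with ⟨w, rfl⟩ | ⟨w, rfl⟩
    · exact ⟨_, hd, (hadj hw hdK).symm⟩
    · exact ⟨_, hc, hadj hcK hw⟩
  · obtain ⟨d, rfl⟩ := O.exists_x_of_adj_y hcd.symm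
    rcases O.cover w with ⟨w, rfl⟩ | ⟨w, rfl⟩
    · exact ⟨_, hc, (hadj hw hcK).symm⟩
    · exact ⟨_, hd, hadj hdK hw⟩

theorem IsAdmissible.exists_adj_of_isPathIn (hO : O.IsAdmissible) (hG : G.Connected) {i : ℕ}
    (hi : i < O.k) {Q : List V} {a b : V} (hQ : IsPathIn G (O.K i) a b Q) (hab : a ≠ b) {w : V}
    (hw : w ∈ O.K i) : ∃ z ∈ Q, G.Adj z w := by
  obtain ⟨c, hc, d, hd, hcd⟩ := exists_adj_of_isChain hQ.1 hQ.head_mem hQ.getLast_mem hab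
  exact hO.exists_adj_of_mem_K hG hi hc hd (hQ.2.2.2.2 c hc) (hQ.2.2.2.2 d hd) hcd hw

/-- `P` is a path through the blocks `K 0, …, K i` which dominates them. -/
structure IsPathThrough (O : BipartiteOrdering G (n + 1) (m + 1)) (i : ℕ) (P : List V) : Prop where
  isChain : P.IsChain G.Adj
  nodup : P.Nodup
  getLast : P.getLast? = some (O.exit i)
  mem_K : ∀ v ∈ P, ∃ j ≤ i, v ∈ O.K j
  dominates : ∀ j ≤ i, ∀ w ∈ O.K j, w ∈ P ∨ ∃ z ∈ P, G.Adj z w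
  exit_mem : ∀ j ≤ i, O.exit j ∈ P
  exists_adj : ∃ z ∈ P, G.Adj (O.x 0) z

theorem isPathThrough_zero (hO : O.IsAdmissible) (hG : G.Connected) (σ : Choices G) :
    O.IsPathThrough 0 (O.loop σ 1).1 := by
  have hk := hO.k_pos hG
  have hexit := exit_mem_K hO hG hk
  have hlX := lX_mem_K hO hG hk
  have hrY := rY_mem_K hO hG hk
  change O.IsPathThrough 0 (O.init.1 ++ σ.path O.init.1 (O.K 0) O.init.2 (O.exit 0))
  -- A start different from the exit forces an edge into the first piece, and this edge dominates
  -- the block.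
  have of_empty : ∀ v ∈ O.K 0, G.Adj (O.x 0) v → v ≠ O.exit 0 →
      O.IsPathThrough 0 ([] ++ σ.path [] (O.K 0) v (O.exit 0)) := by
    intro v hv hadj hne
    obtain ⟨Q, hQ⟩ := hO.exists_isPathIn hG hk hv hexit
    obtain ⟨h, -⟩ := σ.path_spec [] (O.K 0) v (O.exit 0) ⟨Q, hQ, List.disjoint_nil_left _⟩
    rw [List.nil_append]
    refine ⟨h.1, h.2.1, h.2.2.2.1, fun w hw => ⟨0, le_rfl, h.2.2.2.2 w hw⟩, ?_, ?_,
      v, h.head_mem, hadj⟩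
    · intro j hj w hw
      rw [Nat.le_zero.1 hj] at hw
      exact .inr (hO.exists_adj_of_isPathIn hG hk h hne hw)
    · intro j hj
      rw [Nat.le_zero.1 hj]
      exact h.getLast_mem
  rw [init]
  split_ifs with h1 h2
  · refine of_empty _ hrY h1 ?_
    rw [h2]
    exact (O.x_ne_y _ _).symm
  · have hadj : G.Adj (O.lX (O.K 0)) (O.rY (O.K 0)) := hO.adj_of_mem_K hG hk hlX hrY
    -- The start `r_Y` may itself be the exit; then the prefixed `ℓ_X` provides the edge. Otherwise
    -- the exit is `r_X ≠ ℓ_X`, and a single edge avoids the prefix.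
    have hQ : ∃ Q, IsPathIn G (O.K 0) (O.rY (O.K 0)) (O.exit 0) Q ∧
        List.Disjoint [O.lX (O.K 0)] Q := by
      rcases O.exit_eq 0 with he | he
      · have hrX := rX_mem_K hO hG hk
        have hadj' : G.Adj (O.rX (O.K 0)) (O.rY (O.K 0)) := hO.adj_of_mem_K hG hk hrX hrY
        rw [he] at h2 ⊢
        exact ⟨[O.rY (O.K 0), O.rX (O.K 0)], by
          simp [IsPathIn, hadj'.symm, hadj'.ne', hrX, hrY], by simp [Ne.symm h2, hadj.ne]⟩
      · rw [he]
        exact ⟨[O.rY (O.K 0)], by simp [IsPathIn, hrY], by simp [hadj.ne']⟩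
    obtain ⟨h, hd⟩ := σ.path_spec _ _ _ _ hQ
    refine ⟨?_, ?_, ?_, ?_, ?_, ?_, O.rY (O.K 0), List.mem_append_right _ h.head_mem, h1⟩
    · refine List.isChain_append.2 ⟨List.isChain_singleton _, h.1, ?_⟩
      simp only [h.2.2.1]
      simpa using hadj
    · exact (List.nodup_singleton _).append h.2.1 hd
    · rw [List.getLast?_append_of_ne_nil _ h.ne_nil, h.2.2.2.1]
    · intro v hv
      refine ⟨0, le_rfl, ?_⟩
      rcases List.mem_append.1 hv with hv | hv
      · rw [List.mem_singleton.1 hv]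
        exact hlX
      · exact h.2.2.2.2 v hv
    · intro j hj w hw
      rw [Nat.le_zero.1 hj] at hw
      exact .inr (hO.exists_adj_of_mem_K hG hk (List.mem_append_left _ (List.mem_singleton_self _))
        (List.mem_append_right _ h.head_mem) hlX hrY hadj hw)
    · intro j hj
      rw [Nat.le_zero.1 hj]
      exact List.mem_append_right _ h.getLast_mem
  · obtain ⟨b, hb⟩ := O.exists_adj_x hG 0
    have hv : G.Adj (O.x 0) (O.y (sInf {j | G.Adj (O.x 0) (O.y j)})) :=
      Set.Nonempty.csInf_mem (s := {j | G.Adj (O.x 0) (O.y j)}) ⟨b, hb⟩ (Set.toFinite _)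
    -- The start is in `Y` and adjacent to `x 0`, so it is neither `r_X` nor, in this case, `r_Y`.
    refine of_empty _ (hO.mem_K_zero hG hv) hv fun he => ?_
    rcases O.exit_eq 0 with h | h
    · exact O.x_ne_y _ _ (he.trans h).symm
    · rw [← h, ← he] at h1
      exact h1 hv

theorem IsPathThrough.succ (hO : O.IsAdmissible) (hG : G.Connected) (σ : Choices G) {i : ℕ}
    (hi : i + 1 < O.k) {P : List V} (hP : O.IsPathThrough i P) :
    O.IsPathThrough (i + 1)
      (P ++ σ.path P (O.K (i + 1)) (O.entry i) (O.exit (i + 1))) := by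
  have hentry := entry_mem_K hO hG hi
  have hexit := exit_mem_K hO hG hi
  have hdisj : ∀ Q : List V, (∀ v ∈ Q, v ∈ O.K (i + 1)) → P.Disjoint Q := by
    intro Q hQ v hvP hvQ
    obtain ⟨j, hj, hvj⟩ := hP.mem_K v hvP
    exact notMem_remaining_of_mem_K hvj (Nat.lt_succ_of_le hj)
      (O.K_subset_remaining _ (hQ v hvQ))
  obtain ⟨Q, hQ⟩ := hO.exists_isPathIn hG hi hentry hexit
  obtain ⟨h, hd⟩ := σ.path_spec P _ _ _ ⟨Q, hQ, hdisj Q hQ.2.2.2.2⟩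
  refine ⟨?_, hP.nodup.append h.2.1 hd, ?_, ?_, ?_, ?_, ?_⟩
  · refine List.isChain_append.2 ⟨hP.isChain, h.1, ?_⟩
    simp only [h.2.2.1, hP.getLast]
    simpa using (hO.adj_exit hG hi).1
  · rw [List.getLast?_append_of_ne_nil _ h.ne_nil, h.2.2.2.1]
  · intro v hv
    rcases List.mem_append.1 hv with hv | hv
    · obtain ⟨j, hj, hvj⟩ := hP.mem_K v hv
      exact ⟨j, by omega, hvj⟩
    · exact ⟨i + 1, le_rfl, h.2.2.2.2 v hv⟩
  · intro j hj w hw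
    rcases hj.lt_or_eq with hj | rfl
    · rcases hP.dominates j (by omega) w hw with h' | ⟨z, hz, h'⟩
      · exact .inl (List.mem_append_left _ h')
      · exact .inr ⟨z, List.mem_append_left _ hz, h'⟩
    -- The entry is a first vertex of its class and the exit a last one. If they coincide, that
    -- class of the block is a single vertex, which dominates the other class.
    · by_cases hne : O.entry i = O.exit (i + 1)
      · have hmem := List.mem_append_right P h.head_mem
        rcases O.entry_eq i with he | he <;> rcases O.exit_eq (i + 1) with he' | he'
        · rcases O.cover w with ⟨w, rfl⟩ | ⟨w, rfl⟩
          · left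
            rwa [eq_of_lX_eq_rX (he.symm.trans (hne.trans he')) hw, ← he]
          · refine .inr ⟨_, hmem, ?_⟩
            rw [he] at hentry ⊢
            exact hO.adj_of_mem_K hG hi hentry hw
        · exact (O.x_ne_y _ _ (he.symm.trans (hne.trans he'))).elim
        · exact (O.x_ne_y _ _ (he.symm.trans (hne.trans he')).symm).elim
        · rcases O.cover w with ⟨w, rfl⟩ | ⟨w, rfl⟩
          · refine .inr ⟨_, hmem, ?_⟩
            rw [he] at hentry ⊢
            exact (hO.adj_of_mem_K hG hi hw hentry).symm
          · left
            rwa [eq_of_lY_eq_rY (he.symm.trans (hne.trans he')) hw, ← he]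
      · obtain ⟨z, hz, h'⟩ := hO.exists_adj_of_isPathIn hG hi h hne hw
        exact .inr ⟨z, List.mem_append_right _ hz, h'⟩
  · intro j hj
    rcases hj.lt_or_eq with hj | rfl
    · exact List.mem_append_left _ (hP.exit_mem j (by omega))
    · exact List.mem_append_right _ h.getLast_mem
  · obtain ⟨z, hz, h'⟩ := hP.exists_adj
    exact ⟨z, List.mem_append_left _ hz, h'⟩

theorem isPathThrough_loop (hO : O.IsAdmissible) (hG : G.Connected) (σ : Choices G) {i : ℕ}
    (hi : i < O.k) : O.IsPathThrough i (O.loop σ (i + 1)).1 := by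
  induction i with
  | zero => exact isPathThrough_zero hO hG σ
  | succ i ih => exact (ih (Nat.lt_of_succ_lt hi)).succ hO hG σ hi

theorem isPathThrough_mainPart (hO : O.IsAdmissible) (hG : G.Connected) (σ : Choices G) :
    O.IsPathThrough (O.k - 1) (O.mainPart σ) := by
  have hk := hO.k_pos hG
  have h := isPathThrough_loop hO hG σ (i := O.k - 1) (by omega)
  rwa [loop, O.exit_last (by omega)] at h

/-- A path through all blocks is dominating once it meets the neighbourhood of the last vertex
of `X`. -/
theorem IsPathThrough.dominates_of_subset (hO : O.IsAdmissible) (hG : G.Connected) {P P' : List V}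
    (hP : O.IsPathThrough (O.k - 1) P) (hPP' : P ⊆ P')
    (hlast : ∃ z ∈ P', G.Adj (O.x (Fin.last n)) z) (w : V) :
    w ∈ P' ∨ ∃ z ∈ P', G.Adj z w := by
  have hk := hO.k_pos hG
  obtain ⟨z, hz, hlast⟩ := hlast
  have core : w ∈ O.remaining 0 → w ∈ P' ∨ ∃ z ∈ P', G.Adj z w := by
    intro hw
    obtain ⟨j, hj, hw | hw⟩ := exists_mem_K_or_mem_J hO hG hw
    · rcases hP.dominates j (by omega) w hw with h | ⟨z, hz, h⟩
      · exact .inl (hPP' h)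
      · exact .inr ⟨z, hPP' hz, h⟩
    · have hexit := hPP' (hP.exit_mem j (by omega))
      by_cases hj' : j + 1 = O.k
      · obtain ⟨-, h2, h3⟩ := hO.adj_exit_last hG hj'
        rcases O.cover w with ⟨a, rfl⟩ | ⟨b, rfl⟩
        · exact .inr ⟨z, hz, (h3 a hw z hlast).symm⟩
        · exact .inr ⟨_, hexit, h2 b hw⟩
      · exact .inr ⟨_, hexit, (hO.adj_exit hG (by omega)).2 w hw⟩
  rcases O.cover w with ⟨a, rfl⟩ | ⟨b, rfl⟩
  · rcases lt_or_ge a O.L with ha | ha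
    -- To the left of `x_L` neighbourhoods increase, so a neighbour of `x 0` on the path dominates
    -- all these vertices.
    · obtain ⟨z', hz', h⟩ := hP.exists_adj
      refine .inr ⟨z', hPP' hz', SimpleGraph.Adj.symm ?_⟩
      rcases (Fin.zero_le a).eq_or_lt with h0 | h0
      · rwa [← h0]
      · exact hO.nested 0 a (.inl ⟨h0, ha.le⟩) h
    rcases lt_or_ge O.R a with ha' | ha'
    · refine .inr ⟨z, hz, SimpleGraph.Adj.symm ?_⟩
      rcases (Fin.le_last a).eq_or_lt with h0 | h0
      · rwa [h0]
      · exact hO.nested _ a (.inr ⟨ha'.le, h0⟩) hlast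
    · exact core (.inl ⟨a, ha, ha', rfl⟩)
  · exact core (.inr ⟨b, rfl⟩)

theorem IsPathThrough.isDominatingPath_append (hO : O.IsAdmissible) (hG : G.Connected) {P : List V}
    (hP : O.IsPathThrough (O.k - 1) P) {w : V} (hwP : w ∉ P) (hw : G.Adj (O.exit (O.k - 1)) w)
    (hlast : G.Adj (O.x (Fin.last n)) w) : IsDominatingPath G (P ++ [w]) := by
  refine isDominatingPath_of_isChain ?_ ?_ (by simp) (hP.dominates_of_subset hO hG
    (List.subset_append_left _ _) ⟨w, by simp, hlast⟩)
  · refine List.isChain_append.2 ⟨hP.isChain, List.isChain_singleton _, ?_⟩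
    simp only [hP.getLast]
    simpa using hw
  · exact hP.nodup.append (List.nodup_singleton _) (by simpa using hwP)

/-- The algorithm returns a dominating path. -/
theorem IsAdmissible.isDominatingPath_output (hO : O.IsAdmissible) (hG : G.Connected)
    (σ : Choices G) : IsDominatingPath G (O.output σ) := by
  have hk := hO.k_pos hG
  have hP := isPathThrough_mainPart hO hG σ
  obtain ⟨h1, h2, -⟩ := hO.adj_exit_last hG (i := O.k - 1) (by omega)
  rw [output]
  split_ifs with hJ hN
  · obtain ⟨hadj, hmem⟩ := σ.vertex_spec _ hJ
    refine hP.isDominatingPath_append hO hG (fun hw => ?_) (h1 _ hadj) hadj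
    -- The appended vertex is new, since the path stays inside the blocks and `J_k` is disjoint from
    -- them.
    obtain ⟨j, hj, hwj⟩ := hP.mem_K _ hw
    rcases hj.lt_or_eq with hj | rfl
    · exact notMem_remaining_of_mem_K hwj hj hmem.1.1
    · exact hmem.1.2 hwj
  · refine isDominatingPath_of_isChain hP.isChain hP.nodup ?_
      (hP.dominates_of_subset hO hG (List.Subset.refl _) hN)
    rintro h
    simpa [h] using hP.getLast
  · have hadj : G.Adj (O.x (Fin.last n)) (σ.vertex (G.neighborSet (O.x (Fin.last n)))) := by
      obtain ⟨b, hb⟩ := O.exists_adj_x hG (Fin.last n)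
      exact σ.vertex_spec (G.neighborSet (O.x (Fin.last n))) ⟨_, hb⟩
    exact hP.isDominatingPath_append hO hG (fun hw => hN ⟨_, hw, hadj⟩) (h1 _ hadj) hadj

end Loop

end BipartiteOrdering

/-- Covers an empty colour class: a connected graph without edges has only one vertex. -/
theorem isDominatingPath_singleton {V : Type*} {G : SimpleGraph V} (hG : G.Connected)
    (h : ∀ u v, ¬ G.Adj u v) (v : V) : IsDominatingPath G [v] := by
  refine isDominatingPath_of_isChain (List.isChain_singleton _) (List.nodup_singleton _) (by simp)
    fun w => ?_
  left
  rw [List.mem_singleton]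
  by_contra hne
  have : Nontrivial V := ⟨w, v, hne⟩
  obtain ⟨u, hu⟩ := hG.preconnected.exists_adj_of_nontrivial v
  exact h _ _ hu

/-- Every connected biconvex graph has a dominating path. -/
theorem IsBiconvex.exists_isDominatingPath {V : Type*} {G : SimpleGraph V} (hG : G.Connected)
    (h : IsBiconvex G) : ∃ P, IsDominatingPath G P := by
  obtain ⟨v⟩ := hG.nonempty
  obtain ⟨n, m, O, hO⟩ := h
  rcases n with _ | n
  · refine ⟨[v], isDominatingPath_singleton hG (fun a b hab => ?_) v⟩
    rcases O.cover a with ⟨i, -⟩ | ⟨a, rfl⟩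
    · exact i.elim0
    · exact (O.exists_x_of_adj_y hab.symm).elim fun i _ => i.elim0
  rcases m with _ | m
  · refine ⟨[v], isDominatingPath_singleton hG (fun a b hab => ?_) v⟩
    rcases O.cover a with ⟨a, rfl⟩ | ⟨j, -⟩
    · exact (O.exists_y_of_adj_x hab).elim fun j _ => j.elim0
    · exact j.elim0
  obtain ⟨O', -, -, hO'⟩ := hO.exists_isAdmissible hG
  have : Nonempty V := ⟨v⟩
  obtain ⟨σ⟩ := nonempty_choices G
  exact ⟨_, hO'.isDominatingPath_output hG σ⟩

end BiconvexPath

theorem mainTheorem3 :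
    -- every connected biconvex graph has a dominating path, and path eccentricity at most one
    (∀ (V : Type*) (G : SimpleGraph V), G.Connected → BiconvexPath.IsBiconvex G →
      (∃ P, BiconvexPath.IsDominatingPath G P) ∧ BiconvexPath.pe G ≤ 1) ∧
    -- a biconvex ordering of a connected graph can be replaced by one, with the same colour
    -- classes, from which the algorithm can start
    (∀ (V : Type*) (G : SimpleGraph V) (n m : ℕ)
      (O : BiconvexPath.BipartiteOrdering G (n + 1) (m + 1)), G.Connected → O.IsBiconvex →
      ∃ O' : BiconvexPath.BipartiteOrdering G (n + 1) (m + 1),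
        Set.range O'.x = Set.range O.x ∧ Set.range O'.y = Set.range O.y ∧ O'.IsAdmissible) ∧
    -- from every such ordering, and however its choices are made, the algorithm stops with a
    -- dominating path
    (∀ (V : Type*) (G : SimpleGraph V) (n m : ℕ)
      (O : BiconvexPath.BipartiteOrdering G (n + 1) (m + 1)), G.Connected → O.IsAdmissible →
      (∃ i, O.remaining i = ∅) ∧
        ∀ σ : BiconvexPath.Choices G, BiconvexPath.IsDominatingPath G (O.output σ)) ∧
    -- the bound is attained by the complete bipartite graphs `K_{k,k+2}`, which are `k`-connected
    (∀ k : ℕ, 1 ≤ k →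
      BiconvexPath.IsBiconvex (completeBipartiteGraph (Fin k) (Fin (k + 2))) ∧
      BiconvexPath.IsKConnected (completeBipartiteGraph (Fin k) (Fin (k + 2))) k ∧
      BiconvexPath.pe (completeBipartiteGraph (Fin k) (Fin (k + 2))) = 1) := by
  refine ⟨fun V G hG h => ?_, fun V G n m O hG h => h.exists_isAdmissible hG,
    fun V G n m O hG h => ⟨h.exists_remaining_eq_empty hG, h.isDominatingPath_output hG⟩,
    fun k hk => ⟨BiconvexPath.isBiconvex_completeBipartiteGraph _ _,
      BiconvexPath.isKConnected_completeBipartiteGraph le_rfl (by omega) hk,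
      BiconvexPath.pe_completeBipartiteGraph hk⟩⟩
  obtain ⟨P, hP⟩ := h.exists_isDominatingPath hG
  exact ⟨⟨P, hP⟩, hP.pe_le_one⟩
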